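/- Let $d\ge 1$ and let $X\subset\mathbb R^d$ be a nonempty compact set with $\overline{\operatorname{Int}X}=X$, such that $\partial X$ is smooth ($C^1$ suffices), or $X$ is convex, or, more generally, $X$ satisfies a uniform interior cone condition (each $x\in X$ is the vertex of an open cone of fixed angle and size contained in $\operatorname{Int}X$). For a map $\varphi:X\to X$ put $\|D\varphi\|=\sup_{x\in X}|D\varphi(x)|$. Let $I$ be a finite or countably infinite set. A sequence of families $\Phi^{(n)}=\{\varphi^{(n)}_i:X\to X\}_{i\in I}$, $n\ge 1$, is a *non-autonomous conformal iterated function system* (NCIFS) $\Phi$ if: (a) $\varphi^{(n)}_a(\operatorname{Int}X)\cap\varphi^{(n)}_b(\operatorname{Int}X)=\emptyset$ for all $n$ and $a\ne b$; (b) there is an open connected $V\supset X$ such that every $\varphi_i^{(n)}$ extends to a $C^1$ conformal diffeomorphism of $V$ into $V$; (c) there is $K\ge1$ such that every composition $\varphi=\varphi^{(k)}_{\omega_k}\circ\dots\circ\varphi^{(l)}_{\omega_l}$ (of the extended maps) satisfies $\|D\varphi(x)\|\le K\|D\varphi(y)\|$ for $x,y\in V$; (d) there is $\eta<1$ such that,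 for all sufficiently large $q$, $\|D\varphi(x)\|\le\eta^q$ for all $x\in X$ and all $\varphi=\varphi^{(j)}_{\omega_j}\circ\dots\circ\varphi^{(j+q)}_{\omega_{j+q}}$, $j\ge 1$. For $\omega\in I^n$ write $\varphi_\omega=\varphi^{(1)}_{\omega_1}\circ\dots\circ\varphi^{(n)}_{\omega_n}$. The limit set is $J(\Phi)=\bigcap_{n\ge1}\bigcup_{\omega\in I^n}\varphi_\omega(X)$, and the lower pressure is $\underline P^{\Phi}(t)=\liminf_{n\to\infty}\frac1n\log\sum_{\omega\in I^n}\|D\varphi_\omega\|^t\in[-\infty,\infty]$ for $t\ge0$. Let $T:\Lambda\to\Lambda$ be an invertible (bimeasurable) ergodic transformation preserving a probability measure $m$, and for $\lambda\in\Lambda$ let $\{\varphi_i^\lambda:X\to X\}_{i\in I}$ be maps such that $\lambda\mapsto\varphi^\lambda_i(x)$ is measurable for all $i\in I$, $x\in X$, and such that for every $\lambda$ the sequence $\Phi_\lambda^{(n)}=\{\varphi_i^{T^n(\lambda)}\}_{i\in I}$, $n\ge1$, is an NCIFS $\Phi_\lambda$ (a *random conformal iterated function system*). If $I$ is infinite,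 assume moreover that $$\sup_{i\in I}\frac{\operatorname{ess\,sup}_{\lambda}\|D\varphi_i^\lambda\|}{\operatorname{ess\,inf}_{\lambda}\|D\varphi_i^\lambda\|}<\infty .$$ Let $\mathcal EP(t)$, the *expected pressure*, be the expected value of $\lambda\mapsto\underline P^{\Phi_\lambda}(t)$. Then for every $t\ge0$ one has $\underline P^{\Phi_\lambda}(t)=\mathcal EP(t)$ for almost every $\lambda$, and for almost every $\lambda$ the Hausdorff dimension of the limit set is $$\operatorname{HD}(J(\Phi_\lambda))=\inf\{t\ge0:\mathcal EP(t)\le0\}.$$ -/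

import Mathlib

open MeasureTheory Filter Set
open scoped ENNReal NNReal Topology

noncomputable section

/-- The frontier of `X` is a smooth embedded hypersurface: near each of its points it is a regular
level set. Only `C¹` is asked for, which covers every reading of "smooth". -/
def HasSmoothBoundary {d : ℕ} (X : Set (EuclideanSpace ℝ (Fin d))) : Prop :=
  ∀ x ∈ frontier X, ∃ (U : Set (EuclideanSpace ℝ (Fin d))) (f : EuclideanSpace ℝ (Fin d) → ℝ),
    IsOpen U ∧ x ∈ U ∧ ContDiffOn ℝ 1 f U ∧ fderiv ℝ f x ≠ 0 ∧
      frontier X ∩ U = {y ∈ U | f y = 0}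

/-- Uniform interior cone condition: every point of `X` is the vertex of an open cone, of fixed
opening angle and fixed size, contained in the interior of `X`. -/
def HasInteriorCones {d : ℕ} (X : Set (EuclideanSpace ℝ (Fin d))) : Prop :=
  ∃ c l : ℝ, 0 < c ∧ c < 1 ∧ 0 < l ∧ ∀ x ∈ X, ∃ u : EuclideanSpace ℝ (Fin d), ‖u‖ = 1 ∧
    ∀ y, ‖y - x‖ < l → c * ‖y - x‖ < inner ℝ (y - x) u → y ∈ interior X

/-- The standing assumptions on the set `X ⊆ ℝ^d` on which the systems act. -/
structure IsPhaseSpace {d : ℕ} (X : Set (EuclideanSpace ℝ (Fin d))) : Prop where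
  nonempty : X.Nonempty
  isCompact : IsCompact X
  closure_interior : closure (interior X) = X
  geometry : HasSmoothBoundary X ∨ Convex ℝ X ∨ HasInteriorCones X

/-- `wordMap φ n k ω = φ_{ω₀}^{(k)} ∘ φ_{ω₁}^{(k+1)} ∘ ⋯ ∘ φ_{ω_{n-1}}^{(k+n-1)}`, the map of a word
of `n` letters that starts at level `k`. -/
def wordMap {I E : Type*} (φ : ℕ → I → E → E) : (n : ℕ) → ℕ → (Fin n → I) → E → E
  | 0, _, _ => id
  | n + 1, k, ω => φ k (ω 0) ∘ wordMap φ n (k + 1) (Fin.tail ω)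

/-- `‖Df‖ = sup {|f'(x)| : x ∈ X}` for a map `f` of `X`. -/
def derivNorm {E : Type*} [NormedAddCommGroup E] [NormedSpace ℝ E] (X : Set E) (f : E → E) :
    ℝ≥0∞ :=
  ⨆ x ∈ X, ‖fderivWithin ℝ f X x‖ₑ

/-- `φ` is a non-autonomous conformal iterated function system on `X`. The levels are
`j = 1, 2, 3, …` (the value of `φ` at level `0` is irrelevant), all with the alphabet `I`, and only
the restrictions of the maps `φ j i` to `X` matter. -/
structure IsNCIFS {d : ℕ} {I : Type*} (X : Set (EuclideanSpace ℝ (Fin d)))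
    (φ : ℕ → I → EuclideanSpace ℝ (Fin d) → EuclideanSpace ℝ (Fin d)) : Prop where
  mapsTo : ∀ j, 1 ≤ j → ∀ i, MapsTo (φ j i) X X
  /-- open set condition -/
  disjoint_images : ∀ j, 1 ≤ j → ∀ a b, a ≠ b →
    Disjoint (φ j a '' interior X) (φ j b '' interior X)
  /-- The maps extend to `C¹` conformal diffeomorphisms `ψ j i` of an open connected set `V ⊇ X`
  into itself, and the compositions of the extensions have bounded distortion on `V`. -/
  conformal_distortion : ∃ (V : Set (EuclideanSpace ℝ (Fin d)))
      (ψ : ℕ → I → EuclideanSpace ℝ (Fin d) → EuclideanSpace ℝ (Fin d)),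
    IsOpen V ∧ IsConnected V ∧ X ⊆ V ∧
    (∀ j, 1 ≤ j → ∀ i, EqOn (ψ j i) (φ j i) X ∧ MapsTo (ψ j i) V V ∧ InjOn (ψ j i) V ∧
      ContDiffOn ℝ 1 (ψ j i) V ∧ ∀ x ∈ V, ConformalAt (ψ j i) x) ∧
    ∃ K : ℝ, 1 ≤ K ∧ ∀ n k, 1 ≤ k → ∀ ω : Fin n → I, ∀ x ∈ V, ∀ y ∈ V,
      ‖fderiv ℝ (wordMap ψ n k ω) x‖ ≤ K * ‖fderiv ℝ (wordMap ψ n k ω) y‖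
  /-- uniform contraction -/
  contraction : ∃ η : ℝ, 0 < η ∧ η < 1 ∧ ∃ M : ℕ, ∀ m, M ≤ m → ∀ k, 1 ≤ k →
    ∀ ω : Fin (m + 1) → I, ∀ x ∈ X, ‖fderivWithin ℝ (wordMap φ (m + 1) k ω) X x‖ ≤ η ^ m

/-- The limit set `J = ⋂_{n ≥ 1} ⋃_{ω ∈ I^n} φ_ω(X)`. -/
def limitSet {I E : Type*} (X : Set E) (φ : ℕ → I → E → E) : Set E :=
  ⋂ (n : ℕ) (_ : 1 ≤ n), ⋃ ω : Fin n → I, wordMap φ n 1 ω '' X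

/-- `Z_n(t) = ∑_{ω ∈ I^n} ‖Dφ_ω‖^t`. -/
def partitionSum {I E : Type*} [NormedAddCommGroup E] [NormedSpace ℝ E] (X : Set E)
    (φ : ℕ → I → E → E) (n : ℕ) (t : ℝ≥0) : ℝ≥0∞ :=
  ∑' ω : Fin n → I, derivNorm X (wordMap φ n 1 ω) ^ (t : ℝ)

/-- The lower pressure `liminf_n (1/n) log Z_n(t) ∈ [-∞, ∞]`. -/
def lowerPressure {I E : Type*} [NormedAddCommGroup E] [NormedSpace ℝ E] (X : Set E)
    (φ : ℕ → I → E → E) (t : ℝ≥0) : EReal :=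
  liminf (fun n : ℕ => ((1 / (n : ℝ) : ℝ) : EReal) * ENNReal.log (partitionSum X φ n t)) atTop

/-- The non-autonomous system `Φ_lam`, whose `n`-th level is `{φ_i^{T^n(lam)} : i ∈ I}`. -/
def fiberSystem {Λ I E : Type*} (T : Λ → Λ) (φ : Λ → I → E → E) (lam : Λ) : ℕ → I → E → E :=
  fun n i => φ (T^[n] lam) i

/-- `φ = (φ_i^lam)` is a random conformal iterated function system on `X` over the invertible
ergodic base `T`. -/
structure IsRandomCIFS {d : ℕ} {Λ I : Type*} [MeasurableSpace Λ]
    (X : Set (EuclideanSpace ℝ (Fin d))) (m : Measure Λ) (T : Λ ≃ᵐ Λ)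
    (φ : Λ → I → EuclideanSpace ℝ (Fin d) → EuclideanSpace ℝ (Fin d)) : Prop where
  ergodic : Ergodic (T : Λ → Λ) m
  measurable : ∀ i, ∀ x ∈ X, Measurable fun lam => φ lam i x
  isNCIFS : ∀ lam, IsNCIFS X (fiberSystem T φ lam)

/-- The expected value of an extended real valued random variable. -/
def erealExpectation {Λ : Type*} [MeasurableSpace Λ] (m : Measure Λ) (f : Λ → EReal) : EReal :=
  ((∫⁻ lam, (f lam).toENNReal ∂m : ℝ≥0∞) : EReal) -
    ((∫⁻ lam, (-f lam).toENNReal ∂m : ℝ≥0∞) : EReal)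

/-- The expected pressure: the expected value of the lower pressure of `Φ_lam`. -/
def expectedPressure {Λ I E : Type*} [MeasurableSpace Λ] [NormedAddCommGroup E] [NormedSpace ℝ E]
    (X : Set E) (m : Measure Λ) (T : Λ → Λ) (φ : Λ → I → E → E) (t : ℝ≥0) : EReal :=
  erealExpectation m fun lam => lowerPressure X (fiberSystem T φ lam) t

end

/-!
Conformality makes `‖D(f ∘ g)‖` the product of `‖Df‖` and `‖Dg‖` at each point, so with bounded
distortion the numbers `‖Dφ_ω‖` are multiplicative in the word `ω` up to the factor `K`. Dropping
the first level of a system therefore changes its partition sums by bounded factors and leaves the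
lower pressure unchanged; hence the lower pressure of `Φ_lam` is `T`-invariant, and constant almost
everywhere by ergodicity.

If the lower pressure at `t` is at most `0`, then by uniform contraction the sums
`∑ ‖Dφ_ω‖^s` with `s > t` are bounded along a subsequence, and the cover of the limit set by the
sets `φ_ω(X)` gives `HD(J) ≤ s`.

If the lower pressure at `t` is positive and the alphabet is finite, spread a unit mass over the
words of length `n` proportionally to `‖Dφ_ω‖^t`. Cut each word whose piece meets a ball of radius
`r` at the first letter where the norm drops to `r`. The cones in `X` force every such piece to
occupy a fixed proportion of the volume of a slightly larger ball, so for each length only boundedly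
many words occur, and summing over the lengths bounds the mass by a constant times
`r^t ∑_k Z_k(t)⁻¹`; this series converges because `Z_k(t)` grows exponentially. The mass
distribution principle gives `HD(J) ≥ t`. For an infinite alphabet, comparability of the letters
shows that a large finite subalphabet still has positive lower pressure at `t`.
-/

/-- The union of the balls `B(z + s u, s ρ)`, `0 < s ≤ 1`: a truncated cone with vertex `z`
(excluded) over the ball `B(z + u, ρ)`. -/
def fatCone {E : Type*} [NormedAddCommGroup E] [NormedSpace ℝ E] (z u : E) (ρ : ℝ) : Set E :=
  (fun p : ℝ × E => z + p.1 • p.2) '' (Ioc 0 1 ×ˢ Metric.ball u ρ)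

/-- Every point of `X` is the vertex of a cone over a ball of one fixed radius, contained in the
interior of `X`. This is what the three kinds of phase space have in common. -/
def HasFatCones {E : Type*} [NormedAddCommGroup E] [NormedSpace ℝ E] (X : Set E) : Prop :=
  ∃ ρ > 0, ∀ z ∈ X, ∃ u, fatCone z u ρ ⊆ interior X

section Geometry

variable {E : Type*} [NormedAddCommGroup E] [NormedSpace ℝ E] {X : Set E} {z u x : E} {ρ : ℝ}

lemma fatCone_mono {ρ' : ℝ} (h : ρ ≤ ρ') : fatCone z u ρ ⊆ fatCone z u ρ' :=
  image_mono (prod_mono_right (Metric.ball_subset_ball h))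

lemma ball_subset_fatCone {s : ℝ} (hs : 0 < s) (hs1 : s ≤ 1) :
    Metric.ball (z + s • u) (s * ρ) ⊆ fatCone z u ρ := by
  intro y hy
  refine ⟨(s, s⁻¹ • (y - z)), ⟨⟨hs, hs1⟩, ?_⟩, by simp [smul_inv_smul₀ hs.ne']⟩
  have hsplit : s⁻¹ • (y - z) - u = s⁻¹ • (y - (z + s • u)) := by
    rw [← sub_sub, smul_sub s⁻¹ (y - z), inv_smul_smul₀ hs.ne']
  rw [Metric.mem_ball, dist_eq_norm] at hy ⊢
  rwa [hsplit, norm_smul, norm_inv, Real.norm_of_nonneg hs.le, inv_mul_lt_iff₀ hs]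

lemma insert_fatCone_eq_convexJoin (hρ : 0 < ρ) :
    insert z (fatCone z u ρ) = convexJoin ℝ {z} (Metric.ball (z + u) ρ) := by
  have hball : ∀ q, z + q ∈ Metric.ball (z + u) ρ ↔ q ∈ Metric.ball u ρ := by simp
  ext y
  simp only [convexJoin_singleton_left, mem_iUnion, segment_eq_image', exists_prop]
  constructor
  · rintro (rfl | ⟨⟨s, q⟩, ⟨hs, hq⟩, rfl⟩)
    · exact ⟨y + u, Metric.mem_ball_self hρ, 0, by simp⟩
    · exact ⟨z + q, (hball q).2 hq, s, Ioc_subset_Icc_self hs, by simp⟩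
  · rintro ⟨b, hb, s, hs, rfl⟩
    rcases hs.1.eq_or_lt with rfl | hs0
    · simp
    · exact Or.inr ⟨(s, b - z), ⟨⟨hs0, hs.2⟩, (hball _).1 (by simpa using hb)⟩, rfl⟩

lemma convex_insert_fatCone (hρ : 0 < ρ) : Convex ℝ (insert z (fatCone z u ρ)) := by
  rw [insert_fatCone_eq_convexJoin hρ]
  exact (convex_singleton z).convexJoin (convex_ball _ _)

lemma isPreconnected_fatCone : IsPreconnected (fatCone z u ρ) :=
  (isPreconnected_Ioc.prod (convex_ball u ρ).isPreconnected).image _ (by fun_prop)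

lemma insert_fatCone_subset (hz : z ∈ X) (hu : fatCone z u ρ ⊆ interior X) :
    insert z (fatCone z u ρ) ⊆ X :=
  insert_subset hz (hu.trans interior_subset)

lemma HasFatCones.uniqueDiffOn (hX : HasFatCones X) : UniqueDiffOn ℝ X := by
  obtain ⟨ρ, hρ, hcone⟩ := hX
  intro z hz
  obtain ⟨u, hu⟩ := hcone z hz
  have hball : Metric.ball (z + u) ρ ⊆ insert z (fatCone z u ρ) := by
    simpa using (ball_subset_fatCone one_pos le_rfl).trans (subset_insert z (fatCone z u ρ))
  exact (uniqueDiffWithinAt_convex (convex_insert_fatCone hρ)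
    ((Metric.nonempty_ball.2 hρ).mono (interior_maximal hball Metric.isOpen_ball))
    (subset_closure (mem_insert _ _))).mono (insert_fatCone_subset hz hu)

lemma hasFatCones_of_convex (hX : Convex ℝ X) (hne : (interior X).Nonempty) :
    HasFatCones X := by
  obtain ⟨p, hp⟩ := hne
  obtain ⟨ρ, hρ, hball⟩ := Metric.isOpen_iff.1 isOpen_interior p hp
  refine ⟨ρ, hρ, fun z hz => ⟨p - z, ?_⟩⟩
  rintro _ ⟨⟨s, q⟩, ⟨hs, hq⟩, rfl⟩
  have hqp : z + q ∈ interior X := hball (by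
    rw [mem_ball_iff_norm] at hq ⊢
    convert hq using 2
    abel)
  have := hX.combo_self_interior_mem_interior hz hqp (sub_nonneg.2 hs.2) hs.1 (by ring)
  convert this using 1
  module

lemma HasInteriorCones.hasFatCones {d : ℕ} {X : Set (EuclideanSpace ℝ (Fin d))}
    (hX : HasInteriorCones X) : HasFatCones X := by
  obtain ⟨c, l, hc, hc1, hl, h⟩ := hX
  have h1c : 0 < 1 - c := by linarith
  set ρ := l / 2 * (1 - c) / (1 + c) with hρ
  have hρc : ρ * (1 + c) = l / 2 * (1 - c) := by rw [hρ]; field_simp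
  refine ⟨ρ, by positivity, fun z hz => ?_⟩
  obtain ⟨u, hu, hcone⟩ := h z hz
  refine ⟨(l / 2) • u, ?_⟩
  rintro _ ⟨⟨s, q⟩, ⟨hs, hq⟩, rfl⟩
  obtain ⟨w, rfl⟩ : ∃ w, q = (l / 2) • u + w := ⟨q - (l / 2) • u, by abel⟩
  have hw : ‖w‖ < ρ := by simpa [mem_ball_iff_norm] using hq
  have hnorm : ‖(l / 2) • u + w‖ ≤ l / 2 + ‖w‖ := by
    refine (norm_add_le _ _).trans_eq ?_
    rw [norm_smul, hu, Real.norm_of_nonneg (by positivity), mul_one]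
  have hinner : l / 2 - ‖w‖ ≤ inner ℝ ((l / 2) • u + w) u := by
    rw [inner_add_left, real_inner_smul_left, real_inner_self_eq_norm_sq, hu]
    have := (abs_le.1 (abs_real_inner_le_norm w u)).1
    rw [hu] at this
    linarith
  apply hcone
  · rw [add_sub_cancel_left, norm_smul, Real.norm_of_nonneg hs.1.le]
    nlinarith [hs.1, hs.2, mul_le_mul_of_nonneg_right hs.2 (norm_nonneg ((l / 2) • u + w))]
  · rw [add_sub_cancel_left, norm_smul, Real.norm_of_nonneg hs.1.le, real_inner_smul_left,
      mul_left_comm]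
    gcongr
    · exact hs.1
    · nlinarith

lemma hasFatCones_of_local (hX : IsCompact X)
    (h : ∀ x ∈ X, ∃ ρ > 0, ∀ᶠ z in 𝓝[X] x, ∃ u, fatCone z u ρ ⊆ interior X) :
    HasFatCones X := by
  refine hX.induction_on (p := fun S => ∃ ρ > 0, ∀ z ∈ S, ∃ u, fatCone z u ρ ⊆ interior X)
    ⟨1, one_pos, by simp⟩ ?_ ?_ ?_
  · rintro S S' hS ⟨ρ, hρ, h'⟩
    exact ⟨ρ, hρ, fun z hz => h' z (hS hz)⟩
  · rintro S S' ⟨ρ, hρ, hS⟩ ⟨ρ', hρ', hS'⟩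
    refine ⟨min ρ ρ', lt_min hρ hρ', ?_⟩
    rintro z (hz | hz)
    · exact (hS z hz).imp fun u hu => (fatCone_mono (min_le_left _ _)).trans hu
    · exact (hS' z hz).imp fun u hu => (fatCone_mono (min_le_right _ _)).trans hu
  · intro x hx
    obtain ⟨ρ, hρ, h'⟩ := h x hx
    exact ⟨_, h', ρ, hρ, fun z hz => hz⟩

lemma subset_interior_of_isPreconnected {Y : Type*} [TopologicalSpace Y] {A S : Set Y}
    (hS : IsPreconnected S) (hne : (S ∩ interior A).Nonempty) (hd : Disjoint S (frontier A)) :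
    S ⊆ interior A := by
  have hcover : S ⊆ interior A ∪ (closure A)ᶜ := by
    intro y hy
    by_cases hyA : y ∈ closure A
    · exact Or.inl (by_contra fun hyi => hd.le_bot ⟨hy, hyA, hyi⟩)
    · exact Or.inr hyA
  exact hS.subset_left_of_subset_union isOpen_interior isClosed_closure.isOpen_compl
    (disjoint_compl_right.mono_left (interior_subset.trans subset_closure)) hcover hne

lemma exists_forall_ball_mul_norm_lt {L : E →L[ℝ] ℝ} (hL : L ≠ 0) :
    ∃ ε > 0, ∀ R > 0, ∃ u, ∃ ρ > 0, ∀ w ∈ Metric.ball u ρ, ε * ‖w‖ < L w ∧ ‖w‖ < R := by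
  obtain ⟨v, hv⟩ : ∃ v, 0 < L v := by
    obtain ⟨w, hw⟩ : ∃ w, L w ≠ 0 := by
      by_contra! h
      exact hL (ContinuousLinearMap.ext h)
    rcases hw.lt_or_gt with hw | hw
    exacts [⟨-w, by simpa using hw⟩, ⟨w, hw⟩]
  refine ⟨L v / (‖v‖ + 1), by positivity, fun R hR => ?_⟩
  have hεv : L v / (‖v‖ + 1) * ‖v‖ < L v := by
    rw [div_mul_eq_mul_div, div_lt_iff₀ (by positivity)]
    nlinarith [norm_nonneg v]
  have hopen : IsOpen {w : E | L v / (‖v‖ + 1) * ‖w‖ < L w ∧ ‖w‖ < R} :=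
    (isOpen_lt (by fun_prop) (by fun_prop)).and (isOpen_lt (by fun_prop) (by fun_prop))
  have hδ : 0 < R / (‖v‖ + 1) := by positivity
  refine ⟨(R / (‖v‖ + 1)) • v, Metric.isOpen_iff.1 hopen _ ⟨?_, ?_⟩⟩ <;>
    rw [norm_smul, Real.norm_of_nonneg hδ.le]
  · rw [map_smul, smul_eq_mul, mul_left_comm]
    gcongr
  · rw [div_mul_eq_mul_div, div_lt_iff₀ (by positivity)]
    nlinarith [norm_nonneg v]

lemma exists_eventually_fatCone_lt {f : E → ℝ} {f' : E →L[ℝ] ℝ} (hf : HasStrictFDerivAt f f' x)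
    (hf' : f' ≠ 0) {W : Set E} (hW : W ∈ 𝓝 x) :
    ∃ u, ∃ ρ > 0, ∀ᶠ z in 𝓝 x, ∀ y ∈ fatCone z u ρ, y ∈ W ∧ f z < f y := by
  obtain ⟨ε, hε, hdir⟩ := exists_forall_ball_mul_norm_lt hf'
  have hnear := hf.isLittleO.def hε
  rw [nhds_prod_eq] at hnear
  obtain ⟨U, hU, hUU⟩ := mem_prod_self_iff.1 hnear
  obtain ⟨R, hR, hRU⟩ := Metric.mem_nhds_iff.1 (inter_mem hW hU)
  obtain ⟨u, ρ, hρ, hball⟩ := hdir (R / 2) (half_pos hR)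
  refine ⟨u, ρ, hρ, ?_⟩
  filter_upwards [Metric.ball_mem_nhds x (half_pos hR)] with z hz
  rintro _ ⟨⟨s, w⟩, ⟨hs, hw⟩, rfl⟩
  obtain ⟨hwf, hwR⟩ := hball w hw
  have hsw : ‖s • w‖ < R / 2 := by
    rw [norm_smul, Real.norm_of_nonneg hs.1.le]
    exact (mul_le_of_le_one_left (norm_nonneg w) hs.2).trans_lt hwR
  have hmem : z + s • w ∈ Metric.ball x R := by
    rw [mem_ball_iff_norm] at hz ⊢
    rw [add_sub_right_comm]
    linarith [norm_add_le (z - x) (s • w)]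
  refine ⟨(hRU hmem).1, ?_⟩
  have hest : ‖f (z + s • w) - f z - f' (z + s • w - z)‖ ≤ ε * ‖z + s • w - z‖ :=
    hUU (mk_mem_prod (hRU hmem).2 (hRU (Metric.ball_subset_ball (by linarith) hz)).2)
  rw [add_sub_cancel_left, map_smul, norm_smul, Real.norm_of_nonneg hs.1.le, smul_eq_mul] at hest
  have hgain := mul_lt_mul_of_pos_left hwf hs.1
  linarith [(abs_le.1 hest).1]

lemma exists_fatCone_subset_interior_of_regular {f : E → ℝ} {f' : E →L[ℝ] ℝ}
    (hf : HasStrictFDerivAt f f' x) (hf' : f' ≠ 0) (hfr : ∀ᶠ y in 𝓝 x, y ∈ frontier X → f y = 0) :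
    ∃ u, ∃ ρ > 0, ∃ W ∈ 𝓝 x, ∀ p ∈ W, p ∈ interior X → 0 < f p →
      ∀ z ∈ W, 0 ≤ f z → fatCone z u ρ ⊆ interior X := by
  obtain ⟨u, ρ, hρ, hcone⟩ := exists_eventually_fatCone_lt hf hf' hfr
  refine ⟨u, ρ, hρ, _, inter_mem hcone (inter_mem hfr (Metric.ball_mem_nhds x (half_pos hρ))), ?_⟩
  rintro p ⟨hp, hpfr, hpx⟩ hpi hfp z ⟨hz, -, hzx⟩ hfz
  -- The cones at `p` and at `z` avoid the frontier, and they meet at `p + u`.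
  have hp_cone : insert p (fatCone p u ρ) ⊆ interior X := by
    refine subset_interior_of_isPreconnected (convex_insert_fatCone hρ).isPreconnected
      ⟨p, mem_insert _ _, hpi⟩ (disjoint_left.2 ?_)
    rintro y (rfl | hy) hyfr
    exacts [hfp.ne' (hpfr hyfr), (hfp.trans (hp y hy).2).ne' ((hp y hy).1 hyfr)]
  have hp_mem : p + u ∈ fatCone p u ρ :=
    ⟨(1, u), ⟨⟨one_pos, le_rfl⟩, Metric.mem_ball_self hρ⟩, by simp⟩
  have hz_mem : p + u ∈ fatCone z u ρ := by
    have hdist : dist p z < ρ := by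
      linarith [dist_triangle_right p z x, Metric.mem_ball.1 hpx, Metric.mem_ball.1 hzx]
    exact ball_subset_fatCone one_pos le_rfl (by simpa using hdist)
  refine subset_interior_of_isPreconnected isPreconnected_fatCone
    ⟨p + u, hz_mem, hp_cone (mem_insert_of_mem _ hp_mem)⟩ (disjoint_left.2 fun y hy hyfr => ?_)
  exact (hfz.trans_lt (hz y hy).2).ne' ((hz y hy).1 hyfr)

lemma eventually_fatCone_of_mem_interior (hx : x ∈ interior X) :
    ∃ ρ > 0, ∀ᶠ z in 𝓝 x, ∃ u, fatCone z u ρ ⊆ interior X := by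
  obtain ⟨R, hR, hball⟩ := Metric.isOpen_iff.1 isOpen_interior x hx
  refine ⟨R / 2, half_pos hR, ?_⟩
  filter_upwards [Metric.ball_mem_nhds x (half_pos hR)] with z hz
  refine ⟨0, ?_⟩
  rintro _ ⟨⟨s, q⟩, ⟨hs, hq⟩, rfl⟩
  apply hball
  rw [mem_ball_iff_norm] at hz ⊢
  have hsq : ‖s • q‖ ≤ ‖q‖ := by
    rw [norm_smul, Real.norm_of_nonneg hs.1.le]
    exact mul_le_of_le_one_left (norm_nonneg q) hs.2
  rw [add_sub_right_comm]
  linarith [norm_add_le (z - x) (s • q), mem_ball_zero_iff.1 hq]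

lemma eventually_fatCone_of_regular_frontier {f : E → ℝ} {f' : E →L[ℝ] ℝ}
    (hf : HasStrictFDerivAt f f' x) (hf' : f' ≠ 0)
    (hfr : ∀ᶠ y in 𝓝 x, y ∈ frontier X ↔ f y = 0) (hx : x ∈ closure (interior X)) :
    ∃ ρ > 0, ∀ᶠ z in 𝓝[X] x, ∃ u, fatCone z u ρ ⊆ interior X := by
  obtain ⟨u, ρ, hρ, W, hW, hpos⟩ :=
    exists_fatCone_subset_interior_of_regular hf hf' (hfr.mono fun y => Iff.mp)
  obtain ⟨u', ρ', hρ', W', hW', hneg⟩ := exists_fatCone_subset_interior_of_regular hf.neg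
    (neg_ne_zero.2 hf') (hfr.mono fun y hy h => neg_eq_zero.2 (hy.1 h))
  refine ⟨min ρ ρ', lt_min hρ hρ', ?_⟩
  have hcone : ∀ p ∈ W ∩ W', p ∈ interior X → f p ≠ 0 → ∀ z ∈ W ∩ W', 0 ≤ f p * f z →
      ∃ u, fatCone z u (min ρ ρ') ⊆ interior X := by
    rintro p ⟨hpW, hpW'⟩ hpi hfp z ⟨hzW, hzW'⟩ hpz
    rcases hfp.lt_or_gt with hfp | hfp
    · exact ⟨u', (fatCone_mono (min_le_right _ _)).trans (hneg p hpW' hpi (neg_pos.2 hfp) z hzW'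
        (neg_nonneg.2 (nonpos_of_mul_nonneg_right hpz hfp)))⟩
    · exact ⟨u, (fatCone_mono (min_le_left _ _)).trans (hpos p hpW hpi hfp z hzW
        (nonneg_of_mul_nonneg_right hpz hfp))⟩
  obtain ⟨p, ⟨hp, hpfr⟩, hpi⟩ := mem_closure_iff_nhds.1 hx _ (inter_mem (inter_mem hW hW') hfr)
  have hfp : f p ≠ 0 := fun h0 => (hpfr.2 h0).2 hpi
  filter_upwards [mem_nhdsWithin_of_mem_nhds (inter_mem hW hW'), mem_nhdsWithin_of_mem_nhds hfr,
    self_mem_nhdsWithin] with z hz hzfr hzX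
  by_cases hfz : f z = 0
  · exact hcone p hp hpi hfp z hz (by simp [hfz])
  · have hzi : z ∈ interior X := by_contra fun h => hfz (hzfr.1 ⟨subset_closure hzX, h⟩)
    exact hcone z hz hzi hfz z hz (mul_self_nonneg _)

lemma HasSmoothBoundary.hasFatCones {d : ℕ} {X : Set (EuclideanSpace ℝ (Fin d))}
    (hX : HasSmoothBoundary X) (hc : IsCompact X) (hcl : closure (interior X) = X) :
    HasFatCones X := by
  refine hasFatCones_of_local hc fun x hx => ?_
  by_cases hxi : x ∈ interior X
  · obtain ⟨ρ, hρ, hcone⟩ := eventually_fatCone_of_mem_interior hxi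
    exact ⟨ρ, hρ, hcone.filter_mono nhdsWithin_le_nhds⟩
  · obtain ⟨U, f, hU, hxU, hf, hf', hfr⟩ := hX x ⟨subset_closure hx, hxi⟩
    refine eventually_fatCone_of_regular_frontier
      ((hf.contDiffAt (hU.mem_nhds hxU)).hasStrictFDerivAt one_ne_zero) hf' ?_ (hcl.symm ▸ hx)
    filter_upwards [hU.mem_nhds hxU] with y hy
    simpa [hy] using Set.ext_iff.1 hfr y

lemma IsPhaseSpace.hasFatCones {d : ℕ} {X : Set (EuclideanSpace ℝ (Fin d))}
    (hX : IsPhaseSpace X) : HasFatCones X := by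
  have hne : (interior X).Nonempty := by
    rw [← closure_nonempty_iff, hX.closure_interior]
    exact hX.nonempty
  rcases hX.geometry with h | h | h
  · exact h.hasFatCones hX.isCompact hX.closure_interior
  · exact hasFatCones_of_convex h hne
  · exact h.hasFatCones

end Geometry

section ConformalMaps

variable {E : Type*} [NormedAddCommGroup E] [InnerProductSpace ℝ E]

lemma isConformalMap_fderiv_of_conformalAt {f : E → E} {x : E} (hf : ConformalAt f x) :
    IsConformalMap (fderiv ℝ f x) := by
  obtain ⟨f', hf', hconf⟩ := hf
  rwa [hf'.fderiv]

variable [Nontrivial E] {L M : E →L[ℝ] E}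

lemma norm_smul_linearIsometry (c : ℝ) (li : E →ₗᵢ[ℝ] E) :
    ‖c • li.toContinuousLinearMap‖ = |c| := by
  rw [norm_smul, LinearIsometry.norm_toContinuousLinearMap, mul_one, Real.norm_eq_abs]

lemma norm_apply_of_isConformalMap (hL : IsConformalMap L) (v : E) : ‖L v‖ = ‖L‖ * ‖v‖ := by
  obtain ⟨c, -, li, rfl⟩ := hL
  rw [norm_smul_linearIsometry]
  simp [norm_smul]

lemma norm_pos_of_isConformalMap (hL : IsConformalMap L) : 0 < ‖L‖ := by
  obtain ⟨c, hc, li, rfl⟩ := hL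
  rw [norm_smul_linearIsometry]
  exact abs_pos.2 hc

lemma norm_comp_of_isConformalMap (hL : IsConformalMap L) : ‖L.comp M‖ = ‖L‖ * ‖M‖ := by
  have hpos := norm_pos_of_isConformalMap hL
  refine le_antisymm (L.opNorm_comp_le M) ?_
  rw [mul_comm, ← le_div_iff₀ hpos]
  refine M.opNorm_le_bound (by positivity) fun v => ?_
  rw [div_mul_eq_mul_div, le_div_iff₀ hpos, mul_comm, ← norm_apply_of_isConformalMap hL]
  exact (L.comp M).le_opNorm v

lemma abs_det_of_isConformalMap [FiniteDimensional ℝ E] (hL : IsConformalMap L) :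
    |L.det| = ‖L‖ ^ Module.finrank ℝ E := by
  obtain ⟨c, -, li, rfl⟩ := hL
  have hdet : |LinearMap.det li.toLinearMap| = 1 := by
    rw [← LinearMap.normDet_eq_abs_det, li.normDet_eq_one]
  change |LinearMap.det (c • li.toLinearMap)| = _
  rw [norm_smul_linearIsometry, LinearMap.det_smul, abs_mul, hdet, mul_one, abs_pow]

lemma norm_fderiv_comp_of_conformalAt {f g : E → E} {x : E} (hf : ConformalAt f (g x))
    (hg : ConformalAt g x) :
    ‖fderiv ℝ (f ∘ g) x‖ = ‖fderiv ℝ f (g x)‖ * ‖fderiv ℝ g x‖ := by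
  rw [fderiv_comp x hf.differentiableAt hg.differentiableAt,
    norm_comp_of_isConformalMap (isConformalMap_fderiv_of_conformalAt hf)]

end ConformalMaps

section Words

variable {I E : Type*}

lemma wordMap_cast (φ : ℕ → I → E → E) {m n : ℕ} (h : m = n) (k : ℕ) (ω : Fin n → I) :
    wordMap φ m k (ω ∘ Fin.cast h) = wordMap φ n k ω := by
  subst h
  rfl

lemma wordMap_append (φ : ℕ → I → E → E) {a b : ℕ} (k : ℕ) (ω : Fin a → I) (τ : Fin b → I) :
    wordMap φ (a + b) k (Fin.append ω τ) = wordMap φ a k ω ∘ wordMap φ b (k + a) τ := by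
  induction a generalizing k with
  | zero =>
    rw [Subsingleton.elim ω Fin.elim0, Fin.elim0_append, wordMap_cast]
    rfl
  | succ a ih =>
    rw [← Fin.cons_self_tail ω, Fin.append_cons, wordMap_cast]
    simp only [wordMap, Fin.cons_zero, Fin.tail_cons, ih, Function.comp_assoc, add_right_comm,
      ← add_assoc]

lemma wordMap_comp_letters {I' : Type*} (φ : ℕ → I → E → E) (e : I' → I) (n k : ℕ)
    (ω : Fin n → I') : wordMap (fun j i => φ j (e i)) n k ω = wordMap φ n k (e ∘ ω) := by
  induction n generalizing k with
  | zero => rfl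
  | succ n ih =>
    simp only [wordMap, ih]
    rfl

lemma wordMap_shift (φ : ℕ → I → E → E) (n k : ℕ) (ω : Fin n → I) :
    wordMap (fun j => φ (j + 1)) n k ω = wordMap φ n (k + 1) ω := by
  induction n generalizing k with
  | zero => rfl
  | succ n ih => simp only [wordMap, ih]

lemma mapsTo_wordMap {φ : ℕ → I → E → E} {X : Set E} (h : ∀ j, 1 ≤ j → ∀ i, MapsTo (φ j i) X X)
    {n k : ℕ} (hk : 1 ≤ k) (ω : Fin n → I) : MapsTo (wordMap φ n k ω) X X := by
  induction n generalizing k with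
  | zero => exact mapsTo_id X
  | succ n ih => exact (h k hk _).comp (ih (by omega) _)

end Words

section GrowthRates

variable {u v : ℕ → ℝ≥0∞} {b : ℝ≥0∞}

lemma ereal_exp_mul_natCast (c : ℝ) (n : ℕ) :
    EReal.exp ((c : EReal) * (n : EReal)) = ENNReal.ofReal (Real.exp (c * n)) := by
  rw [← EReal.exp_coe, EReal.coe_mul]
  rfl

lemma ereal_exp_mul_natCast_succ (c : ℝ) (n : ℕ) :
    EReal.exp ((c : EReal) * ((n + 1 : ℕ) : EReal)) =
      EReal.exp c * EReal.exp ((c : EReal) * n) := by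
  rw [ereal_exp_mul_natCast, ereal_exp_mul_natCast, EReal.exp_coe,
    ← ENNReal.ofReal_mul (Real.exp_pos _).le, ← Real.exp_add]
  congr 2
  push_cast
  ring

lemma ereal_exp_coe_ne_zero (c : ℝ) : EReal.exp c ≠ 0 := by
  rw [EReal.exp_coe]
  exact (ENNReal.ofReal_pos.2 (Real.exp_pos c)).ne'

lemma ereal_exp_coe_ne_top (c : ℝ) : EReal.exp c ≠ ∞ := by
  rw [EReal.exp_coe]
  exact ENNReal.ofReal_ne_top

lemma exists_pow_mul_pow_le_of_expGrowthInf_pos (h : 0 < ExpGrowth.expGrowthInf u) :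
    ∃ b : ℝ≥0∞, 1 < b ∧ b ≠ ∞ ∧ ∀ᶠ n : ℕ in atTop, b ^ n * b ^ n ≤ u n := by
  obtain ⟨c, hc0, hcu⟩ := EReal.lt_iff_exists_real_btwn.1 h
  have hc : 0 < c := by exact_mod_cast hc0
  refine ⟨ENNReal.ofReal (Real.exp (c / 2)), ?_, ENNReal.ofReal_ne_top, ?_⟩
  · rw [← ENNReal.ofReal_one]
    exact (ENNReal.ofReal_lt_ofReal_iff (Real.exp_pos _)).2 (by simpa using hc)
  · filter_upwards [ExpGrowth.eventually_exp_le hcu] with n hn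
    refine le_trans (le_of_eq ?_) hn
    rw [ereal_exp_mul_natCast, ← mul_pow, ← ENNReal.ofReal_mul (Real.exp_pos _).le,
      ← Real.exp_add, add_halves, ← ENNReal.ofReal_pow (Real.exp_pos _).le, ← Real.exp_nat_mul,
      mul_comm]

lemma expGrowthInf_pos_of_pow_le (hb : 1 < b) (h : ∀ᶠ n : ℕ in atTop, b ^ n ≤ u n) :
    0 < ExpGrowth.expGrowthInf u := by
  refine lt_of_lt_of_le ?_ (ExpGrowth.expGrowthInf_eventually_monotone h)
  rw [ExpGrowth.expGrowthInf_pow, ← ENNReal.log_one]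
  exact ENNReal.log_strictMono hb

lemma tsum_ne_top_of_eventually_le (hu : ∀ n, u n ≠ ∞) (hv : ∑' n, v n ≠ ∞)
    (huv : ∀ᶠ n in atTop, u n ≤ v n) : ∑' n, u n ≠ ∞ := by
  obtain ⟨N, hN⟩ := eventually_atTop.1 huv
  rw [← (ENNReal.summable (f := fun n => u (n + N))).sum_add_tsum_nat_add']
  refine ENNReal.add_ne_top.2 ⟨ENNReal.sum_ne_top.2 fun n _ => hu n, ne_top_of_le_ne_top hv ?_⟩
  calc ∑' n, u (n + N) ≤ ∑' n, v (n + N) := ENNReal.tsum_le_tsum fun n => hN _ (by omega)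
    _ ≤ ∑' n, v n := ENNReal.tsum_comp_le_tsum_of_injective (add_left_injective N) v

lemma tsum_inv_ne_top_of_expGrowthInf_pos (hu : ∀ n, u n ≠ 0)
    (h : 0 < ExpGrowth.expGrowthInf u) : ∑' n, (u n)⁻¹ ≠ ∞ := by
  obtain ⟨b, hb1, -, hb⟩ := exists_pow_mul_pow_le_of_expGrowthInf_pos h
  refine tsum_ne_top_of_eventually_le (v := fun n => b⁻¹ ^ n)
    (fun n => ENNReal.inv_ne_top.2 (hu n)) ?_ ?_
  · rw [ENNReal.tsum_geometric]
    exact ENNReal.inv_ne_top.2 (tsub_pos_of_lt (ENNReal.inv_lt_one.2 hb1)).ne'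
  · filter_upwards [hb] with n hn
    rw [← ENNReal.inv_pow]
    exact ENNReal.inv_le_inv.2 (le_trans (le_mul_of_one_le_left' (one_le_pow₀ hb1.le)) hn)

lemma expGrowthInf_le_of_forall_exp
    (h : ∀ c : ℝ, (∀ᶠ n : ℕ in atTop, EReal.exp ((c : EReal) * n) ≤ u n) →
      ∃ b : ℝ≥0∞, b ≠ 0 ∧ ∀ᶠ n : ℕ in atTop, b * EReal.exp ((c : EReal) * n) ≤ v n) :
    ExpGrowth.expGrowthInf u ≤ ExpGrowth.expGrowthInf v := by
  refine le_of_forall_lt_imp_le_of_dense fun a ha => ?_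
  obtain ⟨c, hac, hcu⟩ := EReal.lt_iff_exists_real_btwn.1 ha
  obtain ⟨b, hb, hv⟩ := h c (ExpGrowth.eventually_exp_le hcu)
  refine hac.le.trans ?_
  rw [← ExpGrowth.expGrowthInf_exp (a := (c : EReal))]
  exact ExpGrowth.expGrowthInf_of_eventually_ge hb hv

lemma expGrowthInf_le_of_mul_le_succ (hb : b ≠ 0) (h : ∀ n, b * u n ≤ v (n + 1)) :
    ExpGrowth.expGrowthInf u ≤ ExpGrowth.expGrowthInf v := by
  refine expGrowthInf_le_of_forall_exp fun c hc => ⟨b * (EReal.exp c)⁻¹,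
    mul_ne_zero hb (ENNReal.inv_ne_zero.2 (ereal_exp_coe_ne_top c)), ?_⟩
  obtain ⟨N, hN⟩ := eventually_atTop.1 hc
  filter_upwards [eventually_ge_atTop (N + 1)] with n hn
  obtain ⟨k, rfl⟩ : ∃ k, n = k + 1 := ⟨n - 1, by omega⟩
  refine le_trans (le_of_eq ?_) ((mul_le_mul' le_rfl (hN k (by omega))).trans (h k))
  rw [ereal_exp_mul_natCast_succ, mul_assoc, ← mul_assoc _⁻¹,
    ENNReal.inv_mul_cancel (ereal_exp_coe_ne_zero c) (ereal_exp_coe_ne_top c), one_mul]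

lemma expGrowthInf_le_of_succ_mul_le (hb : b ≠ 0) (h : ∀ n, b * u (n + 1) ≤ v n) :
    ExpGrowth.expGrowthInf u ≤ ExpGrowth.expGrowthInf v := by
  refine expGrowthInf_le_of_forall_exp fun c hc => ⟨b * EReal.exp c,
    mul_ne_zero hb (ereal_exp_coe_ne_zero c), ?_⟩
  filter_upwards [(tendsto_add_atTop_nat 1).eventually hc] with n hn
  refine le_trans (le_of_eq ?_) ((mul_le_mul' le_rfl hn).trans (h n))
  rw [ereal_exp_mul_natCast_succ, mul_assoc]

end GrowthRates

section WordSums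

variable {I : Type*}

lemma tsum_append {a b : ℕ} (f : (Fin (a + b) → I) → ℝ≥0∞) :
    ∑' ω, f ω = ∑' ω : Fin a → I, ∑' τ : Fin b → I, f (Fin.append ω τ) := by
  rw [← (Fin.appendEquiv a b).tsum_eq f, ENNReal.tsum_prod']
  rfl

lemma tsum_cons {n : ℕ} (f : (Fin (n + 1) → I) → ℝ≥0∞) :
    ∑' ω, f ω = ∑' i : I, ∑' τ : Fin n → I, f (Fin.cons i τ) := by
  rw [← (Fin.consEquiv fun _ => I).tsum_eq f, ENNReal.tsum_prod']
  rfl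

lemma comp_append {I' : Type*} (e : I → I') {a b : ℕ} (ω : Fin a → I) (τ : Fin b → I) :
    e ∘ Fin.append ω τ = Fin.append (e ∘ ω) (e ∘ τ) := by
  funext x
  refine Fin.addCases (fun y => ?_) (fun y => ?_) x <;> simp

lemma comp_cons {I' : Type*} (e : I → I') {n : ℕ} (i : I) (τ : Fin n → I) :
    e ∘ (Fin.cons i τ : Fin (n + 1) → I) = Fin.cons (e i) (e ∘ τ) := by
  funext x
  exact Fin.cases rfl (fun _ => rfl) x

lemma tsum_le_pow_mul_tsum_of_update_le [Nonempty I] (F : Finset I) (c : ℝ≥0∞) {n : ℕ}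
    (f : (Fin n → I) → ℝ≥0∞)
    (h : ∀ j ω, ∑' i, f (Function.update ω j i) ≤ c * ∑' i : F, f (Function.update ω j i)) :
    ∑' ω, f ω ≤ c ^ n * ∑' ω : Fin n → F, f (Subtype.val ∘ ω) := by
  induction n with
  | zero =>
    rw [pow_zero, one_mul, tsum_fintype, tsum_fintype, Fintype.sum_unique, Fintype.sum_unique]
    exact le_of_eq (congrArg f (Subsingleton.elim _ _))
  | succ n ih =>
    calc ∑' ω, f ω = ∑' i : I, ∑' τ : Fin n → I, f (Fin.cons i τ) := tsum_cons f
      _ ≤ ∑' i : I, c ^ n * ∑' τ : Fin n → F, f (Fin.cons i (Subtype.val ∘ τ)) := by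
          refine ENNReal.tsum_le_tsum fun i => ih (fun τ => f (Fin.cons i τ)) fun j τ => ?_
          simp only [Fin.cons_update]
          exact h j.succ _
      _ = c ^ n * ∑' τ : Fin n → F, ∑' i : I, f (Fin.cons i (Subtype.val ∘ τ)) := by
          rw [ENNReal.tsum_mul_left, ENNReal.tsum_comm]
      _ ≤ c ^ n * ∑' τ : Fin n → F, c * ∑' i : F, f (Fin.cons i (Subtype.val ∘ τ)) := by
          gcongr with τ
          simpa only [Fin.update_cons_zero] using
            h 0 (Fin.cons (Classical.arbitrary I) (Subtype.val ∘ τ))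
      _ = c ^ (n + 1) * ∑' i : F, ∑' τ : Fin n → F, f (Subtype.val ∘ Fin.cons i τ) := by
          simp only [comp_cons]
          rw [ENNReal.tsum_mul_left, ENNReal.tsum_comm, pow_succ, mul_assoc]
      _ = _ := by rw [tsum_cons]

lemma exists_update_eq_append {n : ℕ} (j : Fin n) (ω : Fin n → I) :
    ∃ (p q : ℕ) (hn : p + 1 + q = n) (A : Fin p → I) (B : Fin q → I), ∀ i,
      Function.update ω j i =
        Fin.append (Fin.append A fun _ : Fin 1 => i) B ∘ Fin.cast hn.symm := by
  obtain ⟨p, hp⟩ := j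
  obtain ⟨q, rfl⟩ : ∃ q, n = p + 1 + q := ⟨n - (p + 1), by omega⟩
  refine ⟨p, q, rfl, fun x => ω (Fin.castAdd q (Fin.castAdd 1 x)),
    fun x => ω (Fin.natAdd (p + 1) x), fun i => ?_⟩
  funext x
  simp only [Fin.cast_refl, Function.comp_apply, id_eq]
  refine Fin.addCases (fun y => ?_) (fun y => ?_) x
  · rw [Fin.append_left]
    refine Fin.addCases (fun z => ?_) (fun z => ?_) y
    · rw [Fin.append_left, Function.update_of_ne]
      simp only [ne_eq, Fin.ext_iff, Fin.val_castAdd]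
      omega
    · rw [Fin.append_right]
      convert Function.update_self (⟨p, hp⟩ : Fin (p + 1 + q)) i ω using 2
      ext
      simp
  · rw [Fin.append_right, Function.update_of_ne]
    simp only [ne_eq, Fin.ext_iff, Fin.val_natAdd]
    omega

/-- A weight of words: `w n k ω` is the weight of the word `ω` of `n` letters that starts at
level `k`. The example of interest is the norm of the derivative of `wordMap φ n k ω`. -/
abbrev WordWeight (I : Type*) := (n : ℕ) → ℕ → (Fin n → I) → ℝ≥0∞

namespace WordWeight

/-- The sum of the `t`-th powers of the weights of the words of length `n` starting at
level `k`. -/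
noncomputable def levelSum (w : WordWeight I) (n k : ℕ) (t : ℝ≥0) : ℝ≥0∞ :=
  ∑' ω : Fin n → I, w n k ω ^ (t : ℝ)

/-- The lower pressure of a weight: the lower exponential growth rate of the sums over the words
starting at level `1`. -/
noncomputable def pressure (w : WordWeight I) (t : ℝ≥0) : EReal :=
  ExpGrowth.expGrowthInf fun n => w.levelSum n 1 t

/-- The weight pulled back along a map of alphabets. -/
def comap {I' : Type*} (w : WordWeight I) (e : I' → I) : WordWeight I' :=
  fun n k ω => w n k (e ∘ ω)

/-- The weight with its levels moved down by one. -/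
def shift (w : WordWeight I) : WordWeight I :=
  fun n k ω => w n (k + 1) ω

/-- Positive finite weights that are submultiplicative under concatenation, and multiplicative up
to the factor `K`. Only the levels `k ≥ 1` count. -/
structure IsQuasiMultiplicative (w : WordWeight I) (K : ℝ≥0) : Prop where
  one_le_nil : ∀ k, 1 ≤ k → ∀ ω : Fin 0 → I, 1 ≤ w 0 k ω
  ne_zero : ∀ n k, 1 ≤ k → ∀ ω : Fin n → I, w n k ω ≠ 0
  ne_top : ∀ n k, 1 ≤ k → ∀ ω : Fin n → I, w n k ω ≠ ∞
  append_le : ∀ a b k, 1 ≤ k → ∀ (ω : Fin a → I) (τ : Fin b → I),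
    w (a + b) k (Fin.append ω τ) ≤ w a k ω * w b (k + a) τ
  mul_le_append : ∀ a b k, 1 ≤ k → ∀ (ω : Fin a → I) (τ : Fin b → I),
    w a k ω * w b (k + a) τ ≤ K * w (a + b) k (Fin.append ω τ)

/-- Weights that decay exponentially in the length of the word, uniformly in the level. -/
structure IsContracting (w : WordWeight I) (η : ℝ) (M : ℕ) : Prop where
  pos : 0 < η
  lt_one : η < 1
  le_pow : ∀ m, M ≤ m → ∀ k, 1 ≤ k → ∀ ω : Fin (m + 1) → I,
    w (m + 1) k ω ≤ ENNReal.ofReal (η ^ m)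

/-- The weight of a letter `i` agrees at all levels with `a i`, up to the factor `D`. -/
structure HasComparableLetters (w : WordWeight I) (a : I → ℝ≥0∞) (D : ℝ≥0∞) : Prop where
  factor_ne_top : D ≠ ∞
  ne_zero : ∀ i, a i ≠ 0
  ne_top : ∀ i, a i ≠ ∞
  le : ∀ k, 1 ≤ k → ∀ i, a i ≤ w 1 k fun _ => i
  le_mul : ∀ k, 1 ≤ k → ∀ i, (w 1 k fun _ => i) ≤ D * a i

variable {w : WordWeight I} {K : ℝ≥0} {s t : ℝ≥0} {n k : ℕ}

lemma levelSum_one (w : WordWeight I) (k : ℕ) (t : ℝ≥0) :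
    w.levelSum 1 k t = ∑' i, (w 1 k fun _ => i) ^ (t : ℝ) := by
  rw [levelSum, ← (Equiv.funUnique (Fin 1) I).symm.tsum_eq]
  rfl

lemma levelSum_mul_levelSum (w : WordWeight I) (a b k l : ℕ) (t : ℝ≥0) :
    w.levelSum a k t * w.levelSum b l t =
      ∑' ω : Fin a → I, ∑' τ : Fin b → I, (w a k ω * w b l τ) ^ (t : ℝ) := by
  simp only [ENNReal.mul_rpow_of_nonneg _ _ t.coe_nonneg, ENNReal.tsum_mul_left,
    ENNReal.tsum_mul_right, levelSum]

lemma pressure_of_isEmpty [IsEmpty I] (w : WordWeight I) (t : ℝ≥0) : w.pressure t = ⊥ := by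
  rw [pressure, ← ExpGrowth.expGrowthInf_zero]
  refine ExpGrowth.expGrowthInf_congr ?_
  filter_upwards [eventually_ge_atTop 1] with n hn
  have : IsEmpty (Fin n → I) := ⟨fun ω => isEmptyElim (ω ⟨0, hn⟩)⟩
  simp [levelSum]

namespace IsQuasiMultiplicative

variable (h : w.IsQuasiMultiplicative K)
include h

lemma comap {I' : Type*} (e : I' → I) : (w.comap e).IsQuasiMultiplicative K where
  one_le_nil k hk _ := h.one_le_nil k hk _
  ne_zero n k hk _ := h.ne_zero n k hk _
  ne_top n k hk _ := h.ne_top n k hk _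
  append_le a b k hk ω τ := by
    simpa only [WordWeight.comap, comp_append] using h.append_le a b k hk (e ∘ ω) (e ∘ τ)
  mul_le_append a b k hk ω τ := by
    simpa only [WordWeight.comap, comp_append] using h.mul_le_append a b k hk (e ∘ ω) (e ∘ τ)

lemma shift : w.shift.IsQuasiMultiplicative K where
  one_le_nil k hk := h.one_le_nil (k + 1) (by omega)
  ne_zero n k hk := h.ne_zero n (k + 1) (by omega)
  ne_top n k hk := h.ne_top n (k + 1) (by omega)
  append_le a b k hk ω τ := by
    simpa only [WordWeight.shift, add_right_comm] using h.append_le a b (k + 1) (by omega) ω τ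
  mul_le_append a b k hk ω τ := by
    simpa only [WordWeight.shift, add_right_comm] using h.mul_le_append a b (k + 1) (by omega) ω τ

lemma levelSum_add_le {a b : ℕ} (hk : 1 ≤ k) (t : ℝ≥0) :
    w.levelSum (a + b) k t ≤ w.levelSum a k t * w.levelSum b (k + a) t := by
  rw [levelSum_mul_levelSum, levelSum, tsum_append]
  gcongr with ω τ
  exact h.append_le a b k hk ω τ

lemma levelSum_mul_le {a b : ℕ} (hk : 1 ≤ k) (t : ℝ≥0) :
    w.levelSum a k t * w.levelSum b (k + a) t ≤
      (K : ℝ≥0∞) ^ (t : ℝ) * w.levelSum (a + b) k t := by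
  rw [levelSum_mul_levelSum, levelSum, tsum_append]
  simp only [← ENNReal.tsum_mul_left, ← ENNReal.mul_rpow_of_nonneg _ _ t.coe_nonneg]
  exact ENNReal.tsum_le_tsum fun ω => ENNReal.tsum_le_tsum fun τ =>
    ENNReal.rpow_le_rpow (h.mul_le_append a b k hk ω τ) t.coe_nonneg

lemma levelSum_ne_top [Finite I] (hk : 1 ≤ k) (t : ℝ≥0) : w.levelSum n k t ≠ ∞ := by
  have := Fintype.ofFinite I
  rw [levelSum, tsum_fintype]
  exact ENNReal.sum_ne_top.2 fun ω _ =>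
    ENNReal.rpow_ne_top_of_nonneg t.coe_nonneg (h.ne_top n k hk ω)

lemma levelSum_ne_zero [Nonempty I] (hk : 1 ≤ k) (t : ℝ≥0) : w.levelSum n k t ≠ 0 := by
  intro h0
  have hword := ENNReal.tsum_eq_zero.1 h0 (fun _ => Classical.arbitrary I)
  exact (ENNReal.rpow_pos (pos_iff_ne_zero.2 (h.ne_zero n k hk _)) (h.ne_top n k hk _)).ne' hword

lemma pow_le_levelSum {c : ℝ≥0∞}
    (hc : ∀ k, 1 ≤ k → (K : ℝ≥0∞) ^ (t : ℝ) * c ≤ w.levelSum 1 k t) (n : ℕ) :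
    c ^ n ≤ w.levelSum n 1 t := by
  have hK : (K : ℝ≥0∞) ≠ 0 := by
    intro hK
    have := h.mul_le_append 0 0 1 le_rfl Fin.elim0 Fin.elim0
    rw [hK, zero_mul, nonpos_iff_eq_zero] at this
    exact mul_ne_zero (h.ne_zero _ _ le_rfl _) (h.ne_zero _ _ le_rfl _) this
  have hKt : (K : ℝ≥0∞) ^ (t : ℝ) ≠ 0 :=
    (ENNReal.rpow_pos (pos_iff_ne_zero.2 hK) ENNReal.coe_ne_top).ne'
  induction n with
  | zero =>
    rw [pow_zero, levelSum, tsum_fintype, Fintype.sum_unique]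
    simpa using ENNReal.rpow_le_rpow (h.one_le_nil 1 le_rfl _) t.coe_nonneg
  | succ n ih =>
    rw [← ENNReal.mul_le_mul_iff_right hKt
      (ENNReal.rpow_ne_top_of_nonneg t.coe_nonneg ENNReal.coe_ne_top)]
    calc (K : ℝ≥0∞) ^ (t : ℝ) * c ^ (n + 1) = c ^ n * ((K : ℝ≥0∞) ^ (t : ℝ) * c) := by ring
      _ ≤ w.levelSum n 1 t * w.levelSum 1 (1 + n) t := mul_le_mul' ih (hc _ (by omega))
      _ ≤ _ := h.levelSum_mul_le le_rfl t

lemma pressure_shift (h0 : w.levelSum 1 1 t ≠ 0) (htop : w.levelSum 1 1 t ≠ ∞) :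
    w.shift.pressure t = w.pressure t := by
  have hKtop : (K : ℝ≥0∞) ^ (t : ℝ) ≠ ∞ :=
    ENNReal.rpow_ne_top_of_nonneg t.coe_nonneg ENNReal.coe_ne_top
  have hshift : ∀ n, w.shift.levelSum n 1 t = w.levelSum n (1 + 1) t := fun _ => rfl
  simp only [pressure, hshift]
  refine le_antisymm ?_ ?_
  · refine expGrowthInf_le_of_mul_le_succ
      (b := ((K : ℝ≥0∞) ^ (t : ℝ))⁻¹ * w.levelSum 1 1 t)
      (mul_ne_zero (ENNReal.inv_ne_zero.2 hKtop) h0) fun n => ?_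
    rw [mul_assoc, ← ENNReal.div_eq_inv_mul, add_comm n 1]
    exact ENNReal.div_le_of_le_mul' (h.levelSum_mul_le le_rfl t)
  · refine expGrowthInf_le_of_succ_mul_le (b := (w.levelSum 1 1 t)⁻¹)
      (ENNReal.inv_ne_zero.2 htop) fun n => ?_
    rw [← ENNReal.div_eq_inv_mul, add_comm n 1]
    exact ENNReal.div_le_of_le_mul' (h.levelSum_add_le le_rfl t)

lemma pressure_eq_top [Nonempty I] (htop : w.levelSum 1 1 t = ∞) : w.pressure t = ⊤ := by
  rw [pressure, ← ExpGrowth.expGrowthInf_top]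
  refine ExpGrowth.expGrowthInf_congr ?_
  filter_upwards [eventually_ge_atTop 1] with n hn
  obtain ⟨m, rfl⟩ := Nat.exists_eq_add_of_le hn
  have hle := h.levelSum_mul_le (a := 1) (b := m) le_rfl t
  rw [htop, ENNReal.top_mul (h.levelSum_ne_zero (by omega) t), top_le_iff] at hle
  by_contra hfin
  exact ENNReal.mul_ne_top (ENNReal.rpow_ne_top_of_nonneg t.coe_nonneg ENNReal.coe_ne_top) hfin hle

end IsQuasiMultiplicative

namespace IsContracting

variable {η : ℝ} {M : ℕ} (h : w.IsContracting η M)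
include h

lemma comap {I' : Type*} (e : I' → I) : (w.comap e).IsContracting η M :=
  ⟨h.pos, h.lt_one, fun m hm k hk _ => h.le_pow m hm k hk _⟩

lemma le_one (hn : M + 1 ≤ n) (hk : 1 ≤ k) (ω : Fin n → I) : w n k ω ≤ 1 := by
  obtain ⟨m, rfl⟩ : ∃ m, n = m + 1 := ⟨n - 1, by omega⟩
  refine (h.le_pow m (by omega) k hk ω).trans ?_
  exact ENNReal.ofReal_le_one.2 (pow_le_one₀ h.pos.le h.lt_one.le)

lemma eventually_le {ε : ℝ≥0∞} (hε : 0 < ε) :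
    ∀ᶠ n : ℕ in atTop, ∀ k, 1 ≤ k → ∀ ω : Fin n → I, w n k ω ≤ ε := by
  have hlim : Tendsto (fun m : ℕ => ENNReal.ofReal (η ^ m)) atTop (𝓝 0) := by
    rw [← ENNReal.ofReal_zero]
    exact ENNReal.tendsto_ofReal (tendsto_pow_atTop_nhds_zero_of_lt_one h.pos.le h.lt_one)
  obtain ⟨N, hN⟩ := eventually_atTop.1 (hlim.eventually_le_const hε)
  filter_upwards [eventually_ge_atTop (max M N + 1)] with n hn k hk ω
  obtain ⟨m, rfl⟩ : ∃ m, n = m + 1 := ⟨n - 1, by omega⟩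
  exact (h.le_pow m (by omega) k hk ω).trans (hN m (by omega))

lemma levelSum_anti (hst : t ≤ s) (hn : M + 1 ≤ n) (hk : 1 ≤ k) :
    w.levelSum n k s ≤ w.levelSum n k t :=
  ENNReal.tsum_le_tsum fun ω =>
    ENNReal.rpow_le_rpow_of_exponent_ge (h.le_one hn hk ω) (by exact_mod_cast hst)

lemma antitone_pressure : Antitone w.pressure := by
  intro t s hst
  refine ExpGrowth.expGrowthInf_eventually_monotone ?_
  filter_upwards [eventually_ge_atTop (M + 1)] with n hn
  exact h.levelSum_anti hst hn le_rfl

lemma levelSum_le (hst : t ≤ s) {m : ℕ} (hm : M ≤ m) (hk : 1 ≤ k) :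
    w.levelSum (m + 1) k s ≤ ENNReal.ofReal (η ^ m) ^ ((s : ℝ) - t) * w.levelSum (m + 1) k t := by
  have hst' : (0 : ℝ) ≤ (s : ℝ) - t := sub_nonneg.2 (by exact_mod_cast hst)
  rw [levelSum, levelSum, ← ENNReal.tsum_mul_left]
  refine ENNReal.tsum_le_tsum fun ω => ?_
  calc w (m + 1) k ω ^ (s : ℝ)
      = w (m + 1) k ω ^ ((s : ℝ) - t) * w (m + 1) k ω ^ (t : ℝ) := by
        rw [← ENNReal.rpow_add_of_nonneg _ _ hst' t.coe_nonneg, sub_add_cancel]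
    _ ≤ _ := by
        gcongr
        exact h.le_pow m hm k hk ω

lemma frequently_levelSum_le (hst : t < s) (hP : w.pressure t ≤ 0) :
    ∃ C : ℝ≥0, ∃ᶠ n : ℕ in atTop, w.levelSum n 1 s ≤ C := by
  have hη := h.pos
  have hδ : (0 : ℝ) < (s : ℝ) - t := sub_pos.2 (by exact_mod_cast hst)
  set c : ℝ := -Real.log η * (s - t) with hc
  have hcpos : 0 < c := mul_pos (neg_pos.2 (Real.log_neg hη h.lt_one)) hδ
  have hpow : ∀ m : ℕ, (η ^ m) ^ ((s : ℝ) - t) = Real.exp (-(c * m)) := by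
    intro m
    rw [← Real.rpow_natCast, ← Real.rpow_mul hη.le, Real.rpow_def_of_pos hη, hc]
    ring_nf
  have hfreq := ExpGrowth.frequently_le_exp (u := fun n => w.levelSum n 1 t) (a := (c : EReal))
    (hP.trans_lt (by exact_mod_cast hcpos))
  refine ⟨(Real.exp c).toNNReal, (hfreq.and_eventually (eventually_ge_atTop (M + 1))).mono ?_⟩
  rintro n ⟨hn, hMn⟩
  obtain ⟨m, rfl⟩ : ∃ m, n = m + 1 := ⟨n - 1, by omega⟩
  calc w.levelSum (m + 1) 1 s
      ≤ ENNReal.ofReal (η ^ m) ^ ((s : ℝ) - t) * w.levelSum (m + 1) 1 t :=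
        h.levelSum_le hst.le (by omega) le_rfl
    _ ≤ ENNReal.ofReal (η ^ m) ^ ((s : ℝ) - t) * ENNReal.ofReal (Real.exp (c * (m + 1 : ℕ))) := by
        gcongr
        exact hn.trans_eq (ereal_exp_mul_natCast c _)
    _ = ENNReal.ofReal (Real.exp c) := by
        rw [ENNReal.ofReal_rpow_of_nonneg (by positivity) hδ.le,
          ← ENNReal.ofReal_mul (by positivity), hpow, ← Real.exp_add]
        congr 2
        push_cast
        ring

end IsContracting

namespace HasComparableLetters

variable {a : I → ℝ≥0∞} {D : ℝ≥0∞}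

lemma pressure_shift [Nonempty I] (hw : w.IsQuasiMultiplicative K)
    (ha : w.HasComparableLetters a D) (t : ℝ≥0) : w.shift.pressure t = w.pressure t := by
  by_cases hsum : ∑' i, a i ^ (t : ℝ) = ∞
  · have htop : ∀ k, 1 ≤ k → w.levelSum 1 k t = ∞ := fun k hk => by
      rw [levelSum_one, ← top_le_iff, ← hsum]
      exact ENNReal.tsum_le_tsum fun i => ENNReal.rpow_le_rpow (ha.le k hk i) t.coe_nonneg
    rw [hw.pressure_eq_top (htop 1 le_rfl), hw.shift.pressure_eq_top (htop 2 (by omega))]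
  · refine hw.pressure_shift (hw.levelSum_ne_zero le_rfl t) (ne_top_of_le_ne_top
      (ENNReal.mul_ne_top (ENNReal.rpow_ne_top_of_nonneg t.coe_nonneg ha.factor_ne_top) hsum) ?_)
    rw [levelSum_one, ← ENNReal.tsum_mul_left]
    refine ENNReal.tsum_le_tsum fun i => ?_
    rw [← ENNReal.mul_rpow_of_nonneg _ _ t.coe_nonneg]
    exact ENNReal.rpow_le_rpow (ha.le_mul 1 le_rfl i) t.coe_nonneg

lemma update_mul_le (hw : w.IsQuasiMultiplicative K) (ha : w.HasComparableLetters a D)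
    (ω : Fin n → I) (j : Fin n) (i o : I) :
    w n 1 (Function.update ω j i) * a o ≤
      K * K * D * a i * w n 1 (Function.update ω j o) := by
  obtain ⟨p, q, rfl, A, B, hAB⟩ := exists_update_eq_append j ω
  simp only [Fin.cast_refl, Function.comp_id] at hAB
  rw [hAB, hAB]
  set NA := w p 1 A
  set NB := w q (1 + (p + 1)) B
  have hupper : w (p + 1 + q) 1 (Fin.append (Fin.append A fun _ : Fin 1 => i) B) ≤
      NA * (D * a i) * NB := by
    refine (hw.append_le _ _ _ le_rfl _ _).trans ?_
    gcongr
    refine (hw.append_le _ _ _ le_rfl _ _).trans ?_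
    gcongr
    exact ha.le_mul _ (by omega) i
  have hlower : NA * a o * NB ≤
      K * K * w (p + 1 + q) 1 (Fin.append (Fin.append A fun _ : Fin 1 => o) B) := by
    calc NA * a o * NB ≤ NA * (w 1 (1 + p) fun _ => o) * NB := by
          gcongr
          exact ha.le _ (by omega) o
      _ ≤ K * w (p + 1) 1 (Fin.append A fun _ : Fin 1 => o) * NB :=
          mul_le_mul' (hw.mul_le_append _ _ _ le_rfl A _) le_rfl
      _ ≤ _ := by
          rw [mul_assoc, mul_assoc]
          exact mul_le_mul' le_rfl (hw.mul_le_append _ _ _ le_rfl _ B)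
  calc _ ≤ NA * (D * a i) * NB * a o := by gcongr
    _ = D * a i * (NA * a o * NB) := by ring
    _ ≤ D * a i * (K * K * w (p + 1 + q) 1
          (Fin.append (Fin.append A fun _ : Fin 1 => o) B)) := by gcongr
    _ = _ := by ring

lemma tsum_update_le (hw : w.IsQuasiMultiplicative K) (ha : w.HasComparableLetters a D)
    {F : Finset I} {o : I} (ho : o ∈ F) (t : ℝ≥0) (ω : Fin n → I) (j : Fin n) :
    ∑' i, w n 1 (Function.update ω j i) ^ (t : ℝ) ≤
      (1 + (K * K * D * (a o)⁻¹) ^ (t : ℝ) * ∑' i : {i // i ∉ F}, a i ^ (t : ℝ)) *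
        ∑' i : F, w n 1 (Function.update ω j i) ^ (t : ℝ) := by
  set g : I → ℝ≥0∞ := fun i => w n 1 (Function.update ω j i) ^ (t : ℝ) with hg
  have hsplit : ∑' i, g i = ∑' i : F, g i + ∑' i : {i // i ∉ F}, g i :=
    (ENNReal.summable.tsum_add_tsum_compl (s := (F : Set I)) ENNReal.summable).symm
  have hgo : g o ≤ ∑' i : F, g i := ENNReal.le_tsum (f := fun i : F => g i) ⟨o, ho⟩
  have hgi : ∀ i, g i ≤ (K * K * D * (a o)⁻¹) ^ (t : ℝ) * a i ^ (t : ℝ) * g o := by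
    intro i
    simp only [hg, ← ENNReal.mul_rpow_of_nonneg _ _ t.coe_nonneg]
    refine ENNReal.rpow_le_rpow ?_ t.coe_nonneg
    have hle := ha.update_mul_le hw ω j i o
    rw [← ENNReal.le_div_iff_mul_le (Or.inl (ha.ne_zero o)) (Or.inl (ha.ne_top o))] at hle
    refine hle.trans_eq ?_
    rw [div_eq_mul_inv]
    ring
  change ∑' i, g i ≤ _
  rw [hsplit, add_mul, one_mul]
  gcongr
  calc ∑' i : {i // i ∉ F}, g i
      ≤ ∑' i : {i // i ∉ F}, (K * K * D * (a o)⁻¹) ^ (t : ℝ) * a i ^ (t : ℝ) * g o :=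
        ENNReal.tsum_le_tsum fun i => hgi i
    _ = (K * K * D * (a o)⁻¹) ^ (t : ℝ) * (∑' i : {i // i ∉ F}, a i ^ (t : ℝ)) * g o := by
        rw [ENNReal.tsum_mul_right, ENNReal.tsum_mul_left]
    _ ≤ _ := by gcongr

lemma exists_finset_pressure_pos_of_tsum_eq_top (hw : w.IsQuasiMultiplicative K)
    (ha : w.HasComparableLetters a D) (hsum : ∑' i, a i ^ (t : ℝ) = ∞) :
    ∃ F : Finset I, 0 < (w.comap ((↑) : F → I)).pressure t := by
  have hfin : (K : ℝ≥0∞) ^ (t : ℝ) * 2 < ∑' i, a i ^ (t : ℝ) := by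
    rw [hsum]
    exact ENNReal.mul_lt_top (ENNReal.rpow_lt_top_of_nonneg t.coe_nonneg ENNReal.coe_ne_top)
      ENNReal.ofNat_lt_top
  rw [ENNReal.tsum_eq_iSup_sum, lt_iSup_iff] at hfin
  obtain ⟨F, hF⟩ := hfin
  refine ⟨F, expGrowthInf_pos_of_pow_le (b := 2) (by norm_num)
    (Eventually.of_forall fun n => ?_)⟩
  refine (hw.comap ((↑) : F → I)).pow_le_levelSum (fun k hk => hF.le.trans ?_) n
  rw [levelSum_one, ← Finset.tsum_subtype]
  exact ENNReal.tsum_le_tsum fun i => ENNReal.rpow_le_rpow (ha.le k hk i) t.coe_nonneg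

lemma exists_finset_pressure_pos_of_tsum_ne_top [Nonempty I] (hw : w.IsQuasiMultiplicative K)
    (ha : w.HasComparableLetters a D) (hsum : ∑' i, a i ^ (t : ℝ) ≠ ∞) (hP : 0 < w.pressure t) :
    ∃ F : Finset I, 0 < (w.comap ((↑) : F → I)).pressure t := by
  obtain ⟨b, hb1, hbtop, hb⟩ := exists_pow_mul_pow_le_of_expGrowthInf_pos hP
  set o := Classical.arbitrary I
  set κ := (K * K * D * (a o)⁻¹) ^ (t : ℝ)
  have hκ : κ ≠ ∞ := ENNReal.rpow_ne_top_of_nonneg t.coe_nonneg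
    (ENNReal.mul_ne_top (ENNReal.mul_ne_top (ENNReal.mul_ne_top ENNReal.coe_ne_top
      ENNReal.coe_ne_top) ha.factor_ne_top) (ENNReal.inv_ne_top.2 (ha.ne_zero o)))
  have hlim : Tendsto (fun F : Finset I => 1 + κ * ∑' i : {i // i ∉ F}, a i ^ (t : ℝ)) atTop
      (𝓝 (1 + κ * 0)) :=
    tendsto_const_nhds.add (ENNReal.Tendsto.const_mul
      (ENNReal.tendsto_tsum_compl_atTop_zero hsum) (Or.inr hκ))
  rw [mul_zero, add_zero] at hlim
  obtain ⟨F, hFb, hFo⟩ := ((hlim.eventually_le_const hb1).and (eventually_ge_atTop {o})).exists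
  refine ⟨F, expGrowthInf_pos_of_pow_le hb1 ?_⟩
  filter_upwards [hb] with n hn
  have hsub := tsum_le_pow_mul_tsum_of_update_le F b (fun ω : Fin n → I => w n 1 ω ^ (t : ℝ))
    fun j ω => (ha.tsum_update_le hw (Finset.singleton_subset_iff.1 hFo) t ω j).trans
      (mul_le_mul_left hFb _)
  rw [← ENNReal.mul_le_mul_iff_right (pow_ne_zero n (zero_lt_one.trans hb1).ne')
    (ENNReal.pow_ne_top hbtop)]
  exact hn.trans hsub

lemma exists_finset_pressure_pos [Nonempty I] (hw : w.IsQuasiMultiplicative K)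
    (ha : w.HasComparableLetters a D) (hP : 0 < w.pressure t) :
    ∃ F : Finset I, 0 < (w.comap ((↑) : F → I)).pressure t := by
  by_cases hsum : ∑' i, a i ^ (t : ℝ) = ∞
  · exact ha.exists_finset_pressure_pos_of_tsum_eq_top hw hsum
  · exact ha.exists_finset_pressure_pos_of_tsum_ne_top hw hsum hP

end HasComparableLetters

/-- The words of length `k + 1` along which the weight drops to `r` at the last letter, while all
their proper prefixes lie in `S`. These are the pieces of size about `r` in a mass estimate at
scale `r`. -/
def firstPassage (w : WordWeight I) (r : ℝ≥0∞) (S : (k : ℕ) → Set (Fin k → I)) (k : ℕ) :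
    Set (Fin (k + 1) → I) :=
  {σ | w (k + 1) 1 σ ≤ r ∧ r < w k 1 (Fin.init σ) ∧ Fin.init σ ∈ S k}

variable {r : ℝ≥0∞} {S : (k : ℕ) → Set (Fin k → I)}

lemma exists_take_mem_firstPassage (h0 : ∀ ω, r < w 0 1 ω)
    (hS : ∀ k, ∀ ω ∈ S (k + 1), Fin.init ω ∈ S k) {ω : Fin n → I} (hω : ω ∈ S n)
    (hr : w n 1 ω ≤ r) :
    ∃ k : Fin n, Fin.take (k + 1) k.isLt ω ∈ w.firstPassage r S k := by
  induction n with
  | zero => exact absurd hr (h0 ω).not_ge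
  | succ n ih =>
    by_cases hinit : r < w n 1 (Fin.init ω)
    · exact ⟨Fin.last n, hr, hinit, hS n ω hω⟩
    · obtain ⟨k, hk⟩ := ih (hS n ω hω) (not_lt.1 hinit)
      exact ⟨k.castSucc, hk⟩

lemma encard_firstPassage_le (k : ℕ) :
    (w.firstPassage r S k).encard ≤ {τ ∈ S k | r < w k 1 τ}.encard * ENat.card I := by
  rw [← Set.encard_univ, ← Set.encard_prod]
  refine Set.encard_le_encard_of_injOn (f := fun σ => (Fin.init σ, σ (Fin.last k))) ?_ ?_
  · exact fun σ hσ => ⟨⟨hσ.2.2, hσ.2.1⟩, mem_univ _⟩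
  · intro σ _ σ' _ heq
    simp only [Prod.mk.injEq] at heq
    rw [← Fin.snoc_init_self σ, ← Fin.snoc_init_self σ', heq.1, heq.2]

lemma tsum_firstPassage_le {C : ℝ≥0∞} {k : ℕ} (hC : {τ ∈ S k | r < w k 1 τ}.encard ≤ C)
    (t : ℝ≥0) :
    ∑' σ : w.firstPassage r S k, w (k + 1) 1 σ ^ (t : ℝ) ≤ C * ENat.card I * r ^ (t : ℝ) := by
  calc ∑' σ : w.firstPassage r S k, w (k + 1) 1 σ ^ (t : ℝ)
      ≤ ∑' _ : w.firstPassage r S k, r ^ (t : ℝ) :=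
        ENNReal.tsum_le_tsum fun σ => ENNReal.rpow_le_rpow σ.2.1 t.coe_nonneg
    _ = (w.firstPassage r S k).encard * r ^ (t : ℝ) := ENNReal.tsum_set_const _ _
    _ ≤ _ := by
        gcongr
        refine (ENat.toENNReal_le.2 (encard_firstPassage_le k)).trans ?_
        rw [ENat.toENNReal_mul]
        gcongr

namespace IsQuasiMultiplicative

lemma tsum_preimage_take_le (h : w.IsQuasiMultiplicative K) {a b : ℕ} (t : ℝ≥0)
    (Q : Set (Fin a → I)) :
    ∑' ω : (Fin.take a (Nat.le_add_right a b) : (Fin (a + b) → I) → Fin a → I) ⁻¹' Q,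
        w (a + b) 1 ω ^ (t : ℝ) ≤
      (∑' σ : Q, w a 1 σ ^ (t : ℝ)) * w.levelSum b (1 + a) t := by
  classical
  rw [tsum_subtype _ fun ω => w (a + b) 1 ω ^ (t : ℝ), tsum_subtype _ fun σ => w a 1 σ ^ (t : ℝ),
    tsum_append, levelSum, ← ENNReal.tsum_mul_right]
  refine ENNReal.tsum_le_tsum fun σ => ?_
  rw [← ENNReal.tsum_mul_left]
  refine ENNReal.tsum_le_tsum fun τ => ?_
  have htake : Fin.take a (Nat.le_add_right a b) (Fin.append σ τ) = σ := by
    rw [Fin.take_append_left a le_rfl, Fin.take_eq_self]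
  simp only [indicator_apply, mem_preimage, htake]
  split_ifs
  · rw [← ENNReal.mul_rpow_of_nonneg _ _ t.coe_nonneg]
    exact ENNReal.rpow_le_rpow (h.append_le _ _ _ le_rfl σ τ) t.coe_nonneg
  · exact zero_le

variable [Finite I] [Nonempty I]

lemma levelSum_le_div (h : w.IsQuasiMultiplicative K) (a b : ℕ) (t : ℝ≥0) :
    w.levelSum b (1 + a) t ≤
      (K : ℝ≥0∞) ^ (t : ℝ) * w.levelSum (a + b) 1 t * (w.levelSum a 1 t)⁻¹ := by
  rw [← div_eq_mul_inv, ENNReal.le_div_iff_mul_le (Or.inl (h.levelSum_ne_zero le_rfl t))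
    (Or.inl (h.levelSum_ne_top le_rfl t)), mul_comm]
  exact h.levelSum_mul_le le_rfl t

lemma tsum_le_of_encard_le (h : w.IsQuasiMultiplicative K) (hr1 : r < 1)
    (hS : ∀ k, ∀ ω ∈ S (k + 1), Fin.init ω ∈ S k) {C : ℝ≥0∞}
    (hC : ∀ k, {τ ∈ S k | r < w k 1 τ}.encard ≤ C) (hr : ∀ ω, w n 1 ω ≤ r) (t : ℝ≥0) :
    ∑' ω : S n, w n 1 ω ^ (t : ℝ) ≤
      C * ENat.card I * (K : ℝ≥0∞) ^ (t : ℝ) * (∑' k, (w.levelSum k 1 t)⁻¹) *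
        r ^ (t : ℝ) * w.levelSum n 1 t := by
  set Q : Fin n → Set (Fin n → I) := fun k => Fin.take (k + 1) k.isLt ⁻¹' w.firstPassage r S k
  have hpiece : ∀ k : Fin n, ∑' ω : Q k, w n 1 ω ^ (t : ℝ) ≤
        C * ENat.card I * (K : ℝ≥0∞) ^ (t : ℝ) * r ^ (t : ℝ) * w.levelSum n 1 t *
          (w.levelSum (k + 1) 1 t)⁻¹ := by
    rintro ⟨k, hk⟩
    obtain ⟨m, rfl⟩ := Nat.exists_eq_add_of_le (hk : k + 1 ≤ n)
    refine (h.tsum_preimage_take_le t (w.firstPassage r S k)).trans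
      ((mul_le_mul' (tsum_firstPassage_le (hC k) t) (h.levelSum_le_div (k + 1) m t)).trans_eq ?_)
    ring
  have hcover : S n ⊆ ⋃ k, Q k :=
    fun ω hω => mem_iUnion.2 (exists_take_mem_firstPassage
      (fun ν => hr1.trans_le (h.one_le_nil 1 le_rfl ν)) hS hω (hr ω))
  calc ∑' ω : S n, w n 1 ω ^ (t : ℝ)
      ≤ ∑ k : Fin n, ∑' ω : Q k, w n 1 ω ^ (t : ℝ) :=
        (ENNReal.tsum_mono_subtype (fun ω => w n 1 ω ^ (t : ℝ)) hcover).trans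
          (ENNReal.tsum_iUnion_le (fun ω => w n 1 ω ^ (t : ℝ)) Q)
    _ ≤ ∑ k : Fin n, C * ENat.card I * (K : ℝ≥0∞) ^ (t : ℝ) * r ^ (t : ℝ) * w.levelSum n 1 t *
          (w.levelSum (k + 1) 1 t)⁻¹ := Finset.sum_le_sum fun k _ => hpiece k
    _ ≤ C * ENat.card I * (K : ℝ≥0∞) ^ (t : ℝ) * r ^ (t : ℝ) * w.levelSum n 1 t *
          ∑' k, (w.levelSum k 1 t)⁻¹ := by
        rw [← Finset.mul_sum, ← tsum_fintype (L := SummationFilter.unconditional _)]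
        gcongr
        exact ENNReal.tsum_comp_le_tsum_of_injective
          (f := fun k : Fin n => (k : ℕ) + 1) (fun _ _ hkl => Fin.ext (Nat.succ_injective hkl)) _
    _ = _ := by ring

end IsQuasiMultiplicative

end WordWeight

end WordSums

/-- `ψ` is a family of conformal extensions of the maps `φ` to the domain `V ⊇ X`, with distortion
bounded by `K`. The set `X` is required to have unique derivatives, so that the norms of the
derivatives of the compositions of the maps `φ` within `X` can be computed from `ψ`. -/
structure IsConformalExtension {E I : Type*} [NormedAddCommGroup E] [InnerProductSpace ℝ E]
    (X : Set E) (φ : ℕ → I → E → E) (V : Set E) (ψ : ℕ → I → E → E) (K : ℝ≥0) : Prop where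
  nonempty : X.Nonempty
  uniqueDiffOn : UniqueDiffOn ℝ X
  mapsTo_base : ∀ j, 1 ≤ j → ∀ i, MapsTo (φ j i) X X
  isOpen : IsOpen V
  isPreconnected : IsPreconnected V
  subset : X ⊆ V
  eqOn : ∀ j, 1 ≤ j → ∀ i, EqOn (ψ j i) (φ j i) X
  mapsTo : ∀ j, 1 ≤ j → ∀ i, MapsTo (ψ j i) V V
  injOn : ∀ j, 1 ≤ j → ∀ i, InjOn (ψ j i) V
  contDiffOn : ∀ j, 1 ≤ j → ∀ i, ContDiffOn ℝ 1 (ψ j i) V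
  conformalAt : ∀ j, 1 ≤ j → ∀ i, ∀ x ∈ V, ConformalAt (ψ j i) x
  one_le : 1 ≤ K
  distortion : ∀ n k, 1 ≤ k → ∀ ω : Fin n → I, ∀ x ∈ V, ∀ y ∈ V,
    ‖fderiv ℝ (wordMap ψ n k ω) x‖ₑ ≤ K * ‖fderiv ℝ (wordMap ψ n k ω) y‖ₑ

lemma IsNCIFS.exists_extension {d : ℕ} {I : Type*} {X : Set (EuclideanSpace ℝ (Fin d))}
    {φ : ℕ → I → EuclideanSpace ℝ (Fin d) → EuclideanSpace ℝ (Fin d)} (h : IsNCIFS X φ)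
    (hX : IsPhaseSpace X) : ∃ V ψ K, IsConformalExtension X φ V ψ K := by
  obtain ⟨V, ψ, hV, hVc, hXV, hψ, K, hK, hdist⟩ := h.conformal_distortion
  refine ⟨V, ψ, K.toNNReal, hX.nonempty, hX.hasFatCones.uniqueDiffOn, h.mapsTo, hV,
    hVc.isPreconnected, hXV, fun j hj i => (hψ j hj i).1, fun j hj i => (hψ j hj i).2.1,
    fun j hj i => (hψ j hj i).2.2.1, fun j hj i => (hψ j hj i).2.2.2.1,
    fun j hj i => (hψ j hj i).2.2.2.2, Real.one_le_toNNReal.2 hK, fun n k hk ω x hx y hy => ?_⟩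
  rw [← ofReal_norm, ← ofReal_norm]
  change _ ≤ ENNReal.ofReal K * _
  rw [← ENNReal.ofReal_mul (by linarith)]
  exact ENNReal.ofReal_le_ofReal (hdist n k hk ω x hx y hy)

/-- The weight of a word given by the norm `‖Dφ_ω‖` of the derivative of its map. -/
noncomputable def wordNorm {E I : Type*} [NormedAddCommGroup E] [NormedSpace ℝ E] (X : Set E)
    (φ : ℕ → I → E → E) : WordWeight I :=
  fun n k ω => derivNorm X (wordMap φ n k ω)

section WordNorm

variable {E I : Type*} [NormedAddCommGroup E] [NormedSpace ℝ E]

lemma lowerPressure_eq_pressure (X : Set E) (φ : ℕ → I → E → E) (t : ℝ≥0) :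
    lowerPressure X φ t = (wordNorm X φ).pressure t := by
  unfold lowerPressure WordWeight.pressure ExpGrowth.expGrowthInf
  congr 1
  funext n
  rw [one_div, EReal.coe_inv, mul_comm]
  rfl

lemma wordNorm_comp_letters {I' : Type*} (X : Set E) (φ : ℕ → I → E → E) (e : I' → I) :
    wordNorm X (fun j i => φ j (e i)) = (wordNorm X φ).comap e := by
  funext n k ω
  rw [wordNorm, wordMap_comp_letters]
  rfl

lemma wordNorm_shift (X : Set E) (φ : ℕ → I → E → E) :
    wordNorm X (fun j => φ (j + 1)) = (wordNorm X φ).shift := by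
  funext n k ω
  rw [wordNorm, wordMap_shift]
  rfl

end WordNorm

lemma IsNCIFS.exists_isContracting {d : ℕ} {I : Type*} {X : Set (EuclideanSpace ℝ (Fin d))}
    {φ : ℕ → I → EuclideanSpace ℝ (Fin d) → EuclideanSpace ℝ (Fin d)} (h : IsNCIFS X φ) :
    ∃ η M, (wordNorm X φ).IsContracting η M := by
  obtain ⟨η, h0, h1, M, hM⟩ := h.contraction
  refine ⟨η, M, h0, h1, fun m hm k hk ω => iSup₂_le fun x hx => ?_⟩
  rw [← ofReal_norm]
  exact ENNReal.ofReal_le_ofReal (hM m hm k hk ω x hx)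

namespace IsConformalExtension

variable {E I : Type*} [NormedAddCommGroup E] [InnerProductSpace ℝ E]
  {X V : Set E} {φ ψ : ℕ → I → E → E} {K : ℝ≥0} {n k : ℕ}

variable (h : IsConformalExtension X φ V ψ K)
include h

lemma mapsTo_word (hk : 1 ≤ k) (ω : Fin n → I) :
    MapsTo (wordMap ψ n k ω) V V :=
  mapsTo_wordMap h.mapsTo hk ω

lemma eqOn_word (hk : 1 ≤ k) (ω : Fin n → I) :
    EqOn (wordMap ψ n k ω) (wordMap φ n k ω) X := by
  induction n generalizing k with
  | zero => exact fun x _ => rfl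
  | succ n ih =>
    intro x hx
    simp only [wordMap, Function.comp_apply]
    rw [ih (by omega) _ hx]
    exact h.eqOn k hk _ (mapsTo_wordMap h.mapsTo_base (by omega) _ hx)

lemma injOn_word (hk : 1 ≤ k) (ω : Fin n → I) :
    InjOn (wordMap ψ n k ω) V := by
  induction n generalizing k with
  | zero => exact injOn_id V
  | succ n ih => exact (h.injOn k hk _).comp (ih (by omega) _) (h.mapsTo_word (by omega) _)

lemma conformalAt_word (hk : 1 ≤ k)
    (ω : Fin n → I) {x : E} (hx : x ∈ V) : ConformalAt (wordMap ψ n k ω) x := by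
  induction n generalizing k with
  | zero => exact conformalAt_id x
  | succ n ih =>
    exact (h.conformalAt k hk _ _ (h.mapsTo_word (by omega) _ hx)).comp x (ih (by omega) _)

lemma fderivWithin_word (hk : 1 ≤ k) (ω : Fin n → I) {x : E} (hx : x ∈ X) :
    fderivWithin ℝ (wordMap φ n k ω) X x = fderiv ℝ (wordMap ψ n k ω) x := by
  rw [← fderivWithin_congr (h.eqOn_word hk ω) (h.eqOn_word hk ω hx)]
  exact (h.conformalAt_word hk ω (h.subset hx)).differentiableAt.fderivWithin
    (h.uniqueDiffOn x hx)

lemma wordNorm_eq (hk : 1 ≤ k) (ω : Fin n → I) :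
    wordNorm X φ n k ω = ⨆ x ∈ X, ‖fderiv ℝ (wordMap ψ n k ω) x‖ₑ :=
  biSup_congr fun x hx => by rw [h.fderivWithin_word hk ω hx]

lemma enorm_fderiv_le (hk : 1 ≤ k) (ω : Fin n → I) {x : E} (hx : x ∈ X) :
    ‖fderiv ℝ (wordMap ψ n k ω) x‖ₑ ≤ wordNorm X φ n k ω := by
  rw [h.wordNorm_eq hk]
  exact le_iSup₂ (f := fun x (_ : x ∈ X) => ‖fderiv ℝ (wordMap ψ n k ω) x‖ₑ) x hx

lemma wordNorm_le (hk : 1 ≤ k) (ω : Fin n → I) {x : E} (hx : x ∈ V) :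
    wordNorm X φ n k ω ≤ K * ‖fderiv ℝ (wordMap ψ n k ω) x‖ₑ := by
  rw [h.wordNorm_eq hk]
  exact iSup₂_le fun y hy => h.distortion n k hk ω y (h.subset hy) x hx

lemma enorm_fderiv_le_mul (hk : 1 ≤ k) (ω : Fin n → I) {x : E} (hx : x ∈ V) :
    ‖fderiv ℝ (wordMap ψ n k ω) x‖ₑ ≤ K * wordNorm X φ n k ω := by
  obtain ⟨y, hy⟩ := h.nonempty
  refine (h.distortion n k hk ω x hx y (h.subset hy)).trans ?_
  gcongr
  exact h.enorm_fderiv_le hk ω hy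

lemma wordNorm_ne_top (hk : 1 ≤ k) (ω : Fin n → I) :
    wordNorm X φ n k ω ≠ ∞ := by
  obtain ⟨y, hy⟩ := h.nonempty
  exact ((h.wordNorm_le hk ω (h.subset hy)).trans_lt
    (ENNReal.mul_lt_top ENNReal.coe_lt_top enorm_lt_top)).ne

lemma comp_letters {I' : Type*} (e : I' → I) :
    IsConformalExtension X (fun j i => φ j (e i)) V (fun j i => ψ j (e i)) K where
  nonempty := h.nonempty
  uniqueDiffOn := h.uniqueDiffOn
  mapsTo_base j hj i := h.mapsTo_base j hj (e i)
  isOpen := h.isOpen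
  isPreconnected := h.isPreconnected
  subset := h.subset
  eqOn j hj i := h.eqOn j hj (e i)
  mapsTo j hj i := h.mapsTo j hj (e i)
  injOn j hj i := h.injOn j hj (e i)
  contDiffOn j hj i := h.contDiffOn j hj (e i)
  conformalAt j hj i := h.conformalAt j hj (e i)
  one_le := h.one_le
  distortion n k hk ω := by
    rw [wordMap_comp_letters]
    exact h.distortion n k hk (e ∘ ω)

variable [Nontrivial E]

lemma wordNorm_ne_zero (hk : 1 ≤ k) (ω : Fin n → I) :
    wordNorm X φ n k ω ≠ 0 := by
  obtain ⟨y, hy⟩ := h.nonempty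
  refine (lt_of_lt_of_le ?_ (h.enorm_fderiv_le hk ω hy)).ne'
  rw [enorm_pos]
  exact norm_pos_iff.1 (norm_pos_of_isConformalMap
    (isConformalMap_fderiv_of_conformalAt (h.conformalAt_word hk ω (h.subset hy))))

lemma enorm_fderiv_append {a b : ℕ} (hk : 1 ≤ k)
    (ω : Fin a → I) (τ : Fin b → I) {x : E} (hx : x ∈ V) :
    ‖fderiv ℝ (wordMap ψ (a + b) k (Fin.append ω τ)) x‖ₑ =
      ‖fderiv ℝ (wordMap ψ a k ω) (wordMap ψ b (k + a) τ x)‖ₑ *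
        ‖fderiv ℝ (wordMap ψ b (k + a) τ) x‖ₑ := by
  have hk' : 1 ≤ k + a := by omega
  rw [wordMap_append]
  simp only [← ofReal_norm]
  rw [norm_fderiv_comp_of_conformalAt (h.conformalAt_word hk ω (h.mapsTo_word hk' τ hx))
    (h.conformalAt_word hk' τ hx), ENNReal.ofReal_mul (norm_nonneg _)]

lemma wordNorm_append_le {a b : ℕ} (hk : 1 ≤ k) (ω : Fin a → I) (τ : Fin b → I) :
    wordNorm X φ (a + b) k (Fin.append ω τ) ≤
      wordNorm X φ a k ω * wordNorm X φ b (k + a) τ := by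
  have hk' : 1 ≤ k + a := by omega
  rw [h.wordNorm_eq hk (Fin.append ω τ)]
  refine iSup₂_le fun x hx => ?_
  rw [h.enorm_fderiv_append hk ω τ (h.subset hx)]
  have hx' : wordMap ψ b (k + a) τ x ∈ X := by
    rw [h.eqOn_word hk' τ hx]
    exact mapsTo_wordMap h.mapsTo_base hk' τ hx
  exact mul_le_mul' (h.enorm_fderiv_le hk ω hx') (h.enorm_fderiv_le hk' τ hx)

lemma wordNorm_mul_le_append {a b : ℕ} (hk : 1 ≤ k) (ω : Fin a → I) (τ : Fin b → I) :
    wordNorm X φ a k ω * wordNorm X φ b (k + a) τ ≤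
      K * wordNorm X φ (a + b) k (Fin.append ω τ) := by
  have hk' : 1 ≤ k + a := by omega
  rw [h.wordNorm_eq hk' τ]
  simp only [ENNReal.mul_iSup]
  refine iSup₂_le fun x hx => ?_
  calc wordNorm X φ a k ω * ‖fderiv ℝ (wordMap ψ b (k + a) τ) x‖ₑ
      ≤ K * ‖fderiv ℝ (wordMap ψ a k ω) (wordMap ψ b (k + a) τ x)‖ₑ *
          ‖fderiv ℝ (wordMap ψ b (k + a) τ) x‖ₑ := by
        gcongr
        exact h.wordNorm_le hk ω (h.mapsTo_word hk' τ (h.subset hx))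
    _ = K * ‖fderiv ℝ (wordMap ψ (a + b) k (Fin.append ω τ)) x‖ₑ := by
        rw [h.enorm_fderiv_append hk ω τ (h.subset hx), mul_assoc]
    _ ≤ _ := by
        gcongr
        exact h.enorm_fderiv_le hk _ hx

lemma isQuasiMultiplicative : (wordNorm X φ).IsQuasiMultiplicative K where
  one_le_nil k hk ω := by
    obtain ⟨y, hy⟩ := h.nonempty
    refine le_trans ?_ (h.enorm_fderiv_le hk ω hy)
    rw [← ofReal_norm]
    simp [wordMap]
  ne_zero n k hk ω := h.wordNorm_ne_zero hk ω
  ne_top n k hk ω := h.wordNorm_ne_top hk ω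
  append_le a b k hk ω τ := h.wordNorm_append_le hk ω τ
  mul_le_append a b k hk ω τ := h.wordNorm_mul_le_append hk ω τ

end IsConformalExtension

section Oscillation

variable {E : Type*} [NormedAddCommGroup E] [NormedSpace ℝ E] {V X : Set E}

/-- Every map that is differentiable on `V`, with derivative bounded by `M` there, moves `x` and
`y` at most `L * M` apart. -/
def OscillationLE (V : Set E) (L : ℝ≥0) (x y : E) : Prop :=
  ∀ (f : E → E) (M : ℝ≥0), (∀ z ∈ V, DifferentiableAt ℝ f z) → (∀ z ∈ V, ‖fderiv ℝ f z‖₊ ≤ M) →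
    nndist (f x) (f y) ≤ L * M

namespace OscillationLE

variable {L L' : ℝ≥0} {x y z : E}

lemma mono (h : OscillationLE V L x y) (hL : L ≤ L') : OscillationLE V L' x y :=
  fun f M hf hM => (h f M hf hM).trans (by gcongr)

lemma symm (h : OscillationLE V L x y) : OscillationLE V L y x :=
  fun f M hf hM => nndist_comm (f x) (f y) ▸ h f M hf hM

lemma trans (h : OscillationLE V L x y) (h' : OscillationLE V L' y z) :
    OscillationLE V (L + L') x z :=
  fun f M hf hM => (nndist_triangle _ (f y) _).trans
    ((add_le_add (h f M hf hM) (h' f M hf hM)).trans_eq (add_mul _ _ _).symm)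

end OscillationLE

lemma exists_eventually_oscillationLE (hV : IsOpen V) {x : E} (hx : x ∈ V) :
    ∃ L, ∀ᶠ y in 𝓝 x, OscillationLE V L x y := by
  obtain ⟨r, hr, hball⟩ := Metric.isOpen_iff.1 hV x hx
  lift r to ℝ≥0 using hr.le
  refine ⟨r, eventually_of_mem (Metric.ball_mem_nhds x hr) fun y hy f M hf hM => ?_⟩
  have hmean := (convex_ball x r).norm_image_sub_le_of_norm_fderiv_le
    (fun z hz => hf z (hball hz)) (fun z hz => NNReal.coe_le_coe.2 (hM z (hball hz)))
    hy (Metric.mem_ball_self hr)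
  rw [← NNReal.coe_le_coe, coe_nndist, dist_eq_norm, NNReal.coe_mul, mul_comm]
  refine hmean.trans ?_
  gcongr
  rw [← dist_eq_norm, dist_comm]
  exact (Metric.mem_ball.1 hy).le

lemma exists_oscillationLE (hV : IsOpen V) (hVc : IsPreconnected V) {x y : E} (hx : x ∈ V)
    (hy : y ∈ V) : ∃ L, OscillationLE V L x y := by
  refine hVc.induction₂ (fun x y => ∃ L, OscillationLE V L x y) ?_ ?_ ?_ hx hy
  · intro x hx
    obtain ⟨L, hL⟩ := exists_eventually_oscillationLE hV hx
    filter_upwards [mem_nhdsWithin_of_mem_nhds hL] with y hy using ⟨L, hy⟩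
  · rintro x y z - - - ⟨L, h⟩ ⟨L', h'⟩
    exact ⟨L + L', h.trans h'⟩
  · rintro x y - - ⟨L, h⟩
    exact ⟨L, h.symm⟩

lemma exists_forall_oscillationLE (hV : IsOpen V) (hVc : IsPreconnected V) (hX : IsCompact X)
    (hXV : X ⊆ V) : ∃ L, ∀ x ∈ X, ∀ y ∈ X, OscillationLE V L x y := by
  rcases X.eq_empty_or_nonempty with rfl | ⟨x₀, hx₀⟩
  · exact ⟨0, by simp⟩
  obtain ⟨L, hL⟩ : ∃ L, ∀ y ∈ X, OscillationLE V L x₀ y := by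
    refine hX.induction_on (p := fun S => ∃ L, ∀ y ∈ S, OscillationLE V L x₀ y) ⟨0, by simp⟩
      ?_ ?_ ?_
    · rintro S S' hS ⟨L, h⟩
      exact ⟨L, fun y hy => h y (hS hy)⟩
    · rintro S S' ⟨L, h⟩ ⟨L', h'⟩
      exact ⟨max L L', fun y hy => hy.elim (fun hy => (h y hy).mono (le_max_left _ _))
        fun hy => (h' y hy).mono (le_max_right _ _)⟩
    · intro x hx
      obtain ⟨L, hL⟩ := exists_oscillationLE hV hVc (hXV hx₀) (hXV hx)
      obtain ⟨L', hL'⟩ := exists_eventually_oscillationLE hV (hXV hx)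
      exact ⟨{y | OscillationLE V L' x y}, mem_nhdsWithin_of_mem_nhds hL', L + L',
        fun y hy => hL.trans hy⟩
  exact ⟨L + L, fun x hx y hy => (hL x hx).symm.trans (hL y hy)⟩

end Oscillation

lemma IsConformalExtension.exists_ediam_image_le {E I : Type*} [NormedAddCommGroup E]
    [InnerProductSpace ℝ E] {X V : Set E} {φ ψ : ℕ → I → E → E} {K : ℝ≥0}
    (h : IsConformalExtension X φ V ψ K) (hc : IsCompact X) :
    ∃ L : ℝ≥0, ∀ n k, 1 ≤ k → ∀ ω : Fin n → I,
      Metric.ediam (wordMap φ n k ω '' X) ≤ L * wordNorm X φ n k ω := by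
  obtain ⟨L, hL⟩ := exists_forall_oscillationLE h.isOpen h.isPreconnected hc h.subset
  refine ⟨L * K, fun n k hk ω => ?_⟩
  rw [← (h.eqOn_word hk ω).image_eq]
  refine Metric.ediam_le ?_
  rintro _ ⟨x, hx, rfl⟩ _ ⟨y, hy, rfl⟩
  have hM : ((K * (wordNorm X φ n k ω).toNNReal : ℝ≥0) : ℝ≥0∞) = K * wordNorm X φ n k ω := by
    rw [ENNReal.coe_mul, ENNReal.coe_toNNReal (h.wordNorm_ne_top hk ω)]
  rw [edist_nndist, ENNReal.coe_mul, mul_assoc, ← hM, ← ENNReal.coe_mul, ENNReal.coe_le_coe]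
  refine hL x hx y hy _ _ (fun z hz => (h.conformalAt_word hk ω hz).differentiableAt)
    fun z hz => ?_
  rw [← ENNReal.coe_le_coe, hM]
  exact h.enorm_fderiv_le_mul hk ω hz

section Counting

lemma encard_mul_le_measure_of_pairwiseDisjoint {α ι : Type*} [MeasurableSpace α] {μ : Measure α}
    {T : Set ι} {A : ι → Set α} {B : Set α} {c : ℝ≥0∞} (hA : ∀ i ∈ T, MeasurableSet (A i))
    (hd : T.PairwiseDisjoint A) (hB : ∀ i ∈ T, A i ⊆ B) (hc : ∀ i ∈ T, c ≤ μ (A i)) :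
    (T.encard : ℝ≥0∞) * c ≤ μ B := by
  rw [← ENNReal.tsum_set_const]
  calc ∑' _ : T, c
      ≤ ∑' i : T, μ (A i) := ENNReal.tsum_le_tsum fun i => hc i i.2
    _ ≤ μ (⋃ i : T, A i) := tsum_meas_le_meas_iUnion_of_disjoint μ (fun i => hA i i.2)
        fun i j hij => hd i.2 j.2 (Subtype.coe_injective.ne hij)
    _ ≤ μ B := measure_mono (iUnion_subset fun i => hB i i.2)

variable {E : Type*} [NormedAddCommGroup E]

lemma HasFatCones.exists_norm_le [NormedSpace ℝ E] {X : Set E} (hX : HasFatCones X)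
    (hb : Bornology.IsBounded X) :
    ∃ ρ > 0, ∃ R ≥ 0, ∀ z ∈ X, ∃ u, ‖u‖ ≤ R ∧ fatCone z u ρ ⊆ interior X := by
  obtain ⟨ρ, hρ, hcone⟩ := hX
  obtain ⟨R, hR⟩ := Metric.isBounded_iff.1 hb
  refine ⟨ρ, hρ, max R 0, le_max_right _ _, fun z hz => ?_⟩
  obtain ⟨u, hu⟩ := hcone z hz
  refine ⟨u, le_max_of_le_left ?_, hu⟩
  have hzu : z + u ∈ X := interior_subset (hu (ball_subset_fatCone one_pos le_rfl
    (by simpa using hρ)))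
  simpa [dist_eq_norm] using hR hzu hz

variable [InnerProductSpace ℝ E]

lemma pow_mul_measure_le_measure_image_of_conformalAt [FiniteDimensional ℝ E] [Nontrivial E]
    [MeasurableSpace E] [BorelSpace E] (μ : Measure E) [μ.IsAddHaarMeasure] {f : E → E} {s : Set E}
    {c : ℝ≥0∞} (hs : MeasurableSet s) (hf : ∀ x ∈ s, ConformalAt f x) (hinj : InjOn f s)
    (hc : ∀ x ∈ s, c ≤ ‖fderiv ℝ f x‖ₑ) :
    c ^ Module.finrank ℝ E * μ s ≤ μ (f '' s) := by
  rw [← lintegral_abs_det_fderiv_eq_addHaar_image μ hs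
    (fun x hx => (hf x hx).differentiableAt.hasFDerivAt.hasFDerivWithinAt) hinj,
    ← setLIntegral_const]
  refine setLIntegral_mono' hs fun x hx => ?_
  rw [abs_det_of_isConformalMap (isConformalMap_fderiv_of_conformalAt (hf x hx)),
    ENNReal.ofReal_pow (norm_nonneg _), ofReal_norm]
  exact pow_le_pow_left' (hc x hx) _

namespace IsConformalExtension

variable {I : Type*} {X V : Set E} {φ ψ : ℕ → I → E → E} {K : ℝ≥0} {n k : ℕ}

variable (h : IsConformalExtension X φ V ψ K)
include h

lemma mapsTo_ball_closedBall {ρ s : ℝ} {z u : E} (hk : 1 ≤ k) (ω : Fin n → I) (hz : z ∈ X)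
    (hρ : 0 < ρ) (hu : fatCone z u ρ ⊆ interior X) (hs : 0 < s) (hs1 : s ≤ 1) :
    MapsTo (wordMap φ n k ω) (Metric.ball (z + s • u) (s * ρ))
      (Metric.closedBall (wordMap φ n k ω z)
        ((wordNorm X φ n k ω).toReal * (s * (‖u‖ + ρ)))) := by
  intro w hw
  have hconeX := insert_fatCone_subset hz hu
  have hw' : w ∈ insert z (fatCone z u ρ) := Or.inr (ball_subset_fatCone hs hs1 hw)
  have hder : ∀ v ∈ X, ‖fderiv ℝ (wordMap ψ n k ω) v‖ ≤ (wordNorm X φ n k ω).toReal :=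
    fun v hv => by
      rw [← toReal_enorm]
      exact ENNReal.toReal_mono (h.wordNorm_ne_top hk ω) (h.enorm_fderiv_le hk ω hv)
  have hdist : ‖w - z‖ ≤ s * (‖u‖ + ρ) := by
    have hsu : ‖s • u‖ = s * ‖u‖ := by rw [norm_smul, Real.norm_of_nonneg hs.le]
    rw [mem_ball_iff_norm, ← sub_sub] at hw
    linarith [norm_le_norm_sub_add (w - z) (s • u)]
  rw [mem_closedBall_iff_norm, ← h.eqOn_word hk ω hz, ← h.eqOn_word hk ω (hconeX hw')]
  refine ((convex_insert_fatCone hρ).norm_image_sub_le_of_norm_fderiv_le (𝕜 := ℝ)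
    (fun v hv => (h.conformalAt_word hk ω (h.subset (hconeX hv))).differentiableAt)
    (fun v hv => hder v (hconeX hv)) (mem_insert _ _) hw').trans ?_
  gcongr

variable [FiniteDimensional ℝ E]

lemma mapsTo_interior {j : ℕ} (hj : 1 ≤ j) (i : I) :
    MapsTo (φ j i) (interior X) (interior X) := by
  intro x hx
  have hxV : x ∈ V := h.subset (interior_subset hx)
  have hstrict : HasStrictFDerivAt (ψ j i) (fderiv ℝ (ψ j i) x) x :=
    ((h.contDiffOn j hj i).contDiffAt (h.isOpen.mem_nhds hxV)).hasStrictFDerivAt one_ne_zero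
  have hsurj : (fderiv ℝ (ψ j i) x : E →ₗ[ℝ] E).range = ⊤ :=
    LinearMap.range_eq_top.2 (LinearMap.injective_iff_surjective.1
      (isConformalMap_fderiv_of_conformalAt (h.conformalAt j hj i x hxV)).injective)
  have hmap := hstrict.map_nhds_eq_of_surj hsurj
  rw [mem_interior_iff_mem_nhds, ← h.eqOn j hj i (interior_subset hx), ← hmap, mem_map]
  filter_upwards [mem_interior_iff_mem_nhds.1 hx] with y hy
  rw [mem_preimage, h.eqOn j hj i hy]
  exact h.mapsTo_base j hj i hy

lemma disjoint_word_images
    (hd : ∀ j, 1 ≤ j → ∀ a b, a ≠ b → Disjoint (φ j a '' interior X) (φ j b '' interior X))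
    (hk : 1 ≤ k) {ω τ : Fin n → I} (hωτ : ω ≠ τ) :
    Disjoint (wordMap φ n k ω '' interior X) (wordMap φ n k τ '' interior X) := by
  induction n generalizing k with
  | zero => exact absurd (Subsingleton.elim ω τ) hωτ
  | succ n ih =>
    have hint (σ : Fin n → I) : wordMap φ n (k + 1) σ '' interior X ⊆ interior X :=
      (mapsTo_wordMap (fun j hj i => h.mapsTo_interior hj i) (by omega) σ).image_subset
    simp only [wordMap, image_comp]
    by_cases h0 : ω 0 = τ 0
    · have htail : Fin.tail ω ≠ Fin.tail τ := fun ht =>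
        hωτ (by rw [← Fin.cons_self_tail ω, ← Fin.cons_self_tail τ, h0, ht])
      have hinj : InjOn (φ k (τ 0)) (interior X) :=
        (((h.injOn k hk _).mono h.subset).congr (h.eqOn k hk _)).mono interior_subset
      rw [h0]
      exact (ih (by omega) htail).image hinj (hint _) (hint _)
    · exact (hd k hk _ _ h0).mono (image_mono (hint _)) (image_mono (hint _))

lemma measurableSet_word_image [MeasurableSpace E] [BorelSpace E] {B : Set E} (hk : 1 ≤ k)
    (ω : Fin n → I) (hB : MeasurableSet B) (hBX : B ⊆ X) :
    MeasurableSet (wordMap φ n k ω '' B) := by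
  have hBV := hBX.trans h.subset
  rw [← ((h.eqOn_word hk ω).mono hBX).image_eq]
  exact measurable_image_of_fderivWithin hB (fun x hx =>
    (h.conformalAt_word hk ω (hBV hx)).differentiableAt.hasFDerivAt.hasFDerivWithinAt)
    ((h.injOn_word hk ω).mono hBV)

variable [Nontrivial E]

lemma div_pow_mul_measure_le [MeasurableSpace E] [BorelSpace E] (μ : Measure E)
    [μ.IsAddHaarMeasure] {B : Set E} (hk : 1 ≤ k) (ω : Fin n → I) (hB : MeasurableSet B)
    (hBX : B ⊆ X) :
    (wordNorm X φ n k ω / K) ^ Module.finrank ℝ E * μ B ≤ μ (wordMap φ n k ω '' B) := by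
  have hBV := hBX.trans h.subset
  rw [← ((h.eqOn_word hk ω).mono hBX).image_eq]
  exact pow_mul_measure_le_measure_image_of_conformalAt μ hB
    (fun x hx => h.conformalAt_word hk ω (hBV hx)) ((h.injOn_word hk ω).mono hBV)
    fun x hx => ENNReal.div_le_of_le_mul' (h.wordNorm_le hk ω (hBV hx))

/-- The witness is the ball of the cone at `z` at height `s = r / ‖Dφ_ω‖`, whose image has size
comparable to `r`. -/
lemma exists_measure_word_image_ge [MeasurableSpace E] [BorelSpace E] (μ : Measure E)
    [μ.IsAddHaarMeasure] {ρ r : ℝ} {z u : E} (hk : 1 ≤ k) (ω : Fin n → I) (hz : z ∈ X)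
    (hρ : 0 < ρ) (hu : fatCone z u ρ ⊆ interior X) (hr : 0 < r)
    (hω : ENNReal.ofReal r < wordNorm X φ n k ω) :
    ∃ B ⊆ interior X, MeasurableSet B ∧
      wordMap φ n k ω '' B ⊆ Metric.closedBall (wordMap φ n k ω z) (r * (‖u‖ + ρ)) ∧
      ENNReal.ofReal ((r * ρ / K) ^ Module.finrank ℝ E) * μ (Metric.ball 0 1) ≤
        μ (wordMap φ n k ω '' B) := by
  have htop := h.wordNorm_ne_top hk ω
  obtain ⟨N, hN⟩ : ∃ N, (wordNorm X φ n k ω).toReal = N := ⟨_, rfl⟩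
  have hrN : r < N := hN ▸ (ENNReal.ofReal_lt_iff_lt_toReal hr.le htop).1 hω
  have hN0 : 0 < N := hr.trans hrN
  have hK : (0 : ℝ) < K := lt_of_lt_of_le one_pos h.one_le
  have hs1 : r / N ≤ 1 := (div_le_one hN0).2 hrN.le
  have hB : Metric.ball (z + (r / N) • u) (r / N * ρ) ⊆ interior X :=
    (ball_subset_fatCone (by positivity) hs1).trans hu
  refine ⟨_, hB, measurableSet_ball, ?_, ?_⟩
  · convert (h.mapsTo_ball_closedBall hk ω hz hρ hu (by positivity) hs1).image_subset using 2
    rw [hN]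
    field_simp
  · refine le_of_eq_of_le ?_
      (h.div_pow_mul_measure_le μ hk ω measurableSet_ball (hB.trans interior_subset))
    rw [Measure.addHaar_ball μ (z + _) (by positivity), ← mul_assoc, ← ENNReal.ofReal_toReal htop,
      hN, ← ENNReal.ofReal_coe_nnreal, ← ENNReal.ofReal_div_of_pos hK,
      ← ENNReal.ofReal_pow (by positivity), ← ENNReal.ofReal_mul (by positivity), ← mul_pow]
    congr 3
    field_simp

lemma exists_encard_le
    (hd : ∀ j, 1 ≤ j → ∀ a b, a ≠ b → Disjoint (φ j a '' interior X) (φ j b '' interior X))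
    (hb : Bornology.IsBounded X) (hcone : HasFatCones X) :
    ∃ C : ℝ≥0, ∀ n k, 1 ≤ k → ∀ (x : E) (r : ℝ), 0 < r →
      ({ω : Fin n → I | ENNReal.ofReal r < wordNorm X φ n k ω ∧
        (wordMap φ n k ω '' X ∩ Metric.ball x r).Nonempty}.encard : ℝ≥0∞) ≤ C := by
  let _ : MeasurableSpace E := borel E
  have : BorelSpace E := ⟨rfl⟩
  obtain ⟨ρ, hρ, R, hR, hcone⟩ := hcone.exists_norm_le hb
  have hK : (0 : ℝ) < K := lt_of_lt_of_le one_pos h.one_le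
  refine ⟨((K * (R + ρ + 1) / ρ) ^ Module.finrank ℝ E).toNNReal, fun n k hk x r hr => ?_⟩
  set T := {ω : Fin n → I | ENNReal.ofReal r < wordNorm X φ n k ω ∧
    (wordMap φ n k ω '' X ∩ Metric.ball x r).Nonempty}
  set μ : Measure E := Measure.addHaar
  have hpiece : ∀ ω ∈ T, ∃ B ⊆ interior X, MeasurableSet B ∧
      wordMap φ n k ω '' B ⊆ Metric.ball x (r * (R + ρ + 1)) ∧
      ENNReal.ofReal ((r * ρ / K) ^ Module.finrank ℝ E) * μ (Metric.ball 0 1) ≤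
        μ (wordMap φ n k ω '' B) := by
    rintro ω ⟨hω, _, ⟨z, hz, rfl⟩, hzx⟩
    obtain ⟨u, huR, hu⟩ := hcone z hz
    obtain ⟨B, hBX, hB, hball, hvol⟩ := h.exists_measure_word_image_ge μ hk ω hz hρ hu hr hω
    refine ⟨B, hBX, hB, hball.trans (Metric.closedBall_subset_ball' ?_), hvol⟩
    have := Metric.mem_ball.1 hzx
    nlinarith
  choose! B hBX hB hball hvol using hpiece
  have hcount := encard_mul_le_measure_of_pairwiseDisjoint
    (fun ω hω => h.measurableSet_word_image hk ω (hB ω hω) ((hBX ω hω).trans interior_subset))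
    (fun ω hω τ hτ hne => (h.disjoint_word_images hd hk hne).mono (image_mono (hBX ω hω))
      (image_mono (hBX τ hτ))) hball hvol
  rw [Measure.addHaar_ball μ x (by positivity), ← mul_assoc,
    ENNReal.mul_le_mul_iff_left (Metric.measure_ball_pos μ 0 one_pos).ne' measure_ball_lt_top.ne,
    ← ENNReal.le_div_iff_mul_le (by left; positivity) (by left; exact ENNReal.ofReal_ne_top),
    ← ENNReal.ofReal_div_of_pos (by positivity), ← div_pow] at hcount
  refine hcount.trans_eq ?_
  rw [← ENNReal.ofReal]
  congr 2
  field_simp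

end IsConformalExtension

end Counting

section HausdorffDimension

lemma exists_cover_of_hausdorffMeasure_eq_zero {E : Type*} [EMetricSpace E] [MeasurableSpace E]
    [BorelSpace E] {J : Set E} {t : ℝ} (ht : 0 < t) (hJ : μH[t] J = 0) {ε : ℝ≥0∞} (hε : 0 < ε) :
    ∃ u : ℕ → Set E, J ⊆ ⋃ n, u n ∧ ∑' n, Metric.ediam (u n) ^ t < ε := by
  rw [Measure.hausdorffMeasure_apply] at hJ
  have hlt := ((le_iSup₂ (f := fun (r : ℝ≥0∞) (_ : 0 < r) =>
    ⨅ (u : ℕ → Set E) (_ : J ⊆ ⋃ n, u n) (_ : ∀ n, Metric.ediam (u n) ≤ r),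
      ∑' n, ⨆ _ : (u n).Nonempty, Metric.ediam (u n) ^ t) 1 one_pos).trans hJ.le).trans_lt hε
  simp only [iInf_lt_iff] at hlt
  obtain ⟨u, hcov, -, hsum⟩ := hlt
  refine ⟨u, hcov, lt_of_le_of_lt (ENNReal.tsum_le_tsum fun n => ?_) hsum⟩
  rcases (u n).eq_empty_or_nonempty with hn | hn
  · simp [hn, ht]
  · simp [hn]

lemma exists_ball_cover_of_hausdorffMeasure_eq_zero {E : Type*} [MetricSpace E] [Nonempty E]
    [MeasurableSpace E] [BorelSpace E] {J : Set E} {t : ℝ} (ht : 0 < t) (hJ : μH[t] J = 0)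
    {ε : ℝ≥0} (hε : 0 < ε) :
    ∃ (x : ℕ → E) (r : ℕ → ℝ≥0), (∀ j, 0 < r j) ∧ J ⊆ ⋃ j, Metric.ball (x j) (r j) ∧
      ∑' j, (r j : ℝ≥0∞) ^ t < ε := by
  have hε2 : (0 : ℝ≥0∞) < ε / 2 := ENNReal.half_pos (by exact_mod_cast hε.ne')
  obtain ⟨u, hcov, hsum⟩ := exists_cover_of_hausdorffMeasure_eq_zero ht hJ hε2
  obtain ⟨e, he, hesum⟩ := ENNReal.exists_pos_sum_of_countable hε2.ne' ℕ
  have hx : ∀ j, ∃ x, (u j).Nonempty → x ∈ u j := fun j =>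
    (u j).eq_empty_or_nonempty.elim (fun h => ⟨Classical.arbitrary E, by simp [h]⟩)
      fun ⟨x, hx⟩ => ⟨x, fun _ => hx⟩
  choose x hx using hx
  obtain ⟨ρ, hρt⟩ : ∃ ρ : ℕ → ℝ≥0∞, ∀ j, ρ j ^ t = Metric.ediam (u j) ^ t + e j :=
    ⟨fun j => (Metric.ediam (u j) ^ t + e j) ^ t⁻¹, fun j => ENNReal.rpow_inv_rpow ht.ne' _⟩
  have hρsum : ∑' j, ρ j ^ t < ε := by
    simp only [hρt]
    rw [ENNReal.tsum_add, ← ENNReal.add_halves ε]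
    exact ENNReal.add_lt_add hsum hesum
  have htop : ∀ j, ρ j ≠ ∞ := fun j htop => by
    have := (ENNReal.le_tsum j).trans_lt hρsum
    simp [htop, ht] at this
  lift ρ to ℕ → ℝ≥0 using htop
  have hdiam : ∀ j, Metric.ediam (u j) < ρ j := fun j => by
    rw [← ENNReal.rpow_lt_rpow_iff ht, hρt]
    refine ENNReal.lt_add_right (ne_top_of_lt ((ENNReal.le_tsum j).trans_lt hsum)) ?_
    exact_mod_cast (he j).ne'
  refine ⟨x, ρ, fun j => ENNReal.coe_pos.1 (pos_of_gt (hdiam j)), fun y hy => ?_, hρsum⟩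
  obtain ⟨j, hj⟩ := mem_iUnion.1 (hcov hy)
  refine mem_iUnion.2 ⟨j, ?_⟩
  rw [← Metric.eball_coe]
  exact (Metric.edist_le_ediam_of_mem hj (hx j ⟨y, hj⟩)).trans_lt (hdiam j)

lemma le_dimH_of_forall_finite_ball_cover {E : Type*} [MetricSpace E] [Nonempty E] {J : Set E}
    (hJ : IsCompact J) {t : ℝ≥0} (ht : 0 < t) {C : ℝ≥0}
    (h : ∀ (s : Finset ℕ) (x : ℕ → E) (r : ℕ → ℝ≥0), (∀ j, 0 < r j) → (∀ j, r j < 1) →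
      J ⊆ ⋃ j ∈ s, Metric.ball (x j) (r j) → 1 ≤ C * ∑ j ∈ s, (r j : ℝ≥0∞) ^ (t : ℝ)) :
    t ≤ dimH J := by
  let _ : MeasurableSpace E := borel E
  have : BorelSpace E := ⟨rfl⟩
  refine le_dimH_of_hausdorffMeasure_ne_zero fun hzero => ?_
  obtain ⟨x, r, hr, hcov, hsum⟩ := exists_ball_cover_of_hausdorffMeasure_eq_zero
    (NNReal.coe_pos.2 ht) hzero (ε := (C + 1)⁻¹) (by positivity)
  have hr1 : ∀ j, r j < 1 := fun j => by
    have hC : (((C + 1)⁻¹ : ℝ≥0) : ℝ≥0∞) ≤ 1 := by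
      exact_mod_cast inv_le_one_of_one_le₀ le_add_self
    have := ((ENNReal.le_tsum j).trans_lt hsum).trans_le hC
    contrapose! this
    exact ENNReal.one_le_rpow (by exact_mod_cast this) (NNReal.coe_pos.2 ht)
  obtain ⟨s, hs⟩ := hJ.elim_finite_subcover _ (fun j => Metric.isOpen_ball) hcov
  have hlt : C * (C + 1)⁻¹ < 1 := by
    rw [← div_eq_mul_inv, div_lt_one (by positivity)]
    exact lt_add_one C
  refine (h s x r hr hr1 hs).not_gt (lt_of_le_of_lt ?_ (ENNReal.coe_lt_one_iff.2 hlt))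
  rw [ENNReal.coe_mul]
  gcongr
  exact (ENNReal.sum_le_tsum s).trans hsum.le

namespace IsConformalExtension

variable {E I : Type*} [NormedAddCommGroup E] [InnerProductSpace ℝ E] [Countable I]
  {X V : Set E} {φ ψ : ℕ → I → E → E} {K : ℝ≥0} {η : ℝ} {M : ℕ} {s t : ℝ≥0}

lemma hausdorffMeasure_limitSet_ne_top [MeasurableSpace E] [BorelSpace E]
    (h : IsConformalExtension X φ V ψ K) (hX : IsCompact X)
    (hη : (wordNorm X φ).IsContracting η M) {C : ℝ≥0}
    (hC : ∃ᶠ n in atTop, (wordNorm X φ).levelSum n 1 s ≤ C) :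
    μH[s] (limitSet X φ) ≠ ∞ := by
  obtain ⟨L, hL⟩ := h.exists_ediam_image_le hX
  have hdiam : Tendsto (fun n => ⨆ ω : Fin n → I, Metric.ediam (wordMap φ n 1 ω '' X)) atTop
      (𝓝 0) := by
    refine ENNReal.tendsto_nhds_zero.2 fun ε hε => ?_
    filter_upwards [hη.eventually_le (ENNReal.div_pos hε.ne' (ENNReal.coe_ne_top (r := L)))]
      with n hn
    refine iSup_le fun ω => (hL n 1 le_rfl ω).trans ?_
    grw [hn 1 le_rfl ω, ENNReal.mul_div_le]
  have hle := Measure.hausdorffMeasure_le_liminf_tsum s (limitSet X φ) _ hdiam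
    (fun n (ω : Fin n → I) => wordMap φ n 1 ω '' X) (.of_forall fun n => le_iSup _)
    ((eventually_ge_atTop 1).mono fun n hn => iInter₂_subset n hn)
  refine ne_top_of_le_ne_top (b := (L : ℝ≥0∞) ^ (s : ℝ) * C) (ENNReal.mul_ne_top
    (ENNReal.rpow_ne_top_of_nonneg s.coe_nonneg ENNReal.coe_ne_top) ENNReal.coe_ne_top)
    (hle.trans (liminf_le_of_frequently_le' (hC.mono fun n hn => ?_)))
  calc ∑' ω : Fin n → I, Metric.ediam (wordMap φ n 1 ω '' X) ^ (s : ℝ)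
      ≤ ∑' ω : Fin n → I, (L : ℝ≥0∞) ^ (s : ℝ) * wordNorm X φ n 1 ω ^ (s : ℝ) := by
        refine ENNReal.tsum_le_tsum fun ω => ?_
        rw [← ENNReal.mul_rpow_of_nonneg _ _ s.coe_nonneg]
        exact ENNReal.rpow_le_rpow (hL n 1 le_rfl ω) s.coe_nonneg
    _ = (L : ℝ≥0∞) ^ (s : ℝ) * (wordNorm X φ).levelSum n 1 s := ENNReal.tsum_mul_left
    _ ≤ _ := by gcongr

lemma dimH_limitSet_le (h : IsConformalExtension X φ V ψ K) (hX : IsCompact X)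
    (hη : (wordNorm X φ).IsContracting η M) (hP : (wordNorm X φ).pressure t ≤ 0) :
    dimH (limitSet X φ) ≤ t := by
  let _ : MeasurableSpace E := borel E
  have : BorelSpace E := ⟨rfl⟩
  refine le_of_forall_gt_imp_ge_of_dense fun b hb => ?_
  obtain ⟨s, hts, hsb⟩ := ENNReal.lt_iff_exists_nnreal_btwn.1 hb
  obtain ⟨C, hC⟩ := hη.frequently_levelSum_le (by exact_mod_cast hts) hP
  exact (dimH_le_of_hausdorffMeasure_ne_top
    (h.hausdorffMeasure_limitSet_ne_top hX hη hC)).trans hsb.le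

end IsConformalExtension

end HausdorffDimension

section LimitSet

variable {E I : Type*}

/-- The `n`-th approximation of the limit set: the union of the images of `X` under the words of
length `n` that start at level `1`. -/
def levelSet (X : Set E) (φ : ℕ → I → E → E) (n : ℕ) : Set E :=
  ⋃ ω : Fin n → I, wordMap φ n 1 ω '' X

variable {X : Set E} {φ : ℕ → I → E → E}

lemma image_wordMap_succ_subset (h : ∀ j, 1 ≤ j → ∀ i, MapsTo (φ j i) X X) {n : ℕ}
    (ω : Fin (n + 1) → I) : wordMap φ (n + 1) 1 ω '' X ⊆ wordMap φ n 1 (Fin.init ω) '' X := by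
  have happend : ω = Fin.append (Fin.init ω) fun _ : Fin 1 => ω (Fin.last n) := by
    rw [Fin.append_right_eq_snoc, Fin.snoc_init_self]
  conv_lhs => rw [happend, wordMap_append, image_comp]
  exact image_mono (mapsTo_wordMap h (by omega) _).image_subset

lemma antitone_levelSet (h : ∀ j, 1 ≤ j → ∀ i, MapsTo (φ j i) X X) : Antitone (levelSet X φ) :=
  antitone_nat_of_succ_le fun n => iUnion_subset fun ω =>
    (image_wordMap_succ_subset h ω).trans
      (subset_iUnion (fun τ : Fin n → I => wordMap φ n 1 τ '' X) _)

lemma limitSet_eq_iInter_levelSet (h : ∀ j, 1 ≤ j → ∀ i, MapsTo (φ j i) X X) :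
    limitSet X φ = ⋂ n, levelSet X φ n :=
  subset_antisymm (subset_iInter fun n => (iInter₂_subset (n + 1) (by omega)).trans
    (antitone_levelSet h n.le_succ)) (subset_iInter₂ fun n _ => iInter_subset _ n)

lemma limitSet_comp_letters_subset {I' : Type*} (X : Set E) (φ : ℕ → I → E → E) (e : I' → I) :
    limitSet X (fun j i => φ j (e i)) ⊆ limitSet X φ := by
  refine iInter₂_mono fun n _ => iUnion_subset fun ω => ?_
  rw [wordMap_comp_letters]
  exact subset_iUnion (fun σ : Fin n → I => wordMap φ n 1 σ '' X) (e ∘ ω)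

end LimitSet

namespace IsConformalExtension

variable {E I : Type*} [NormedAddCommGroup E] [InnerProductSpace ℝ E] [Finite I]
  {X V : Set E} {φ ψ : ℕ → I → E → E} {K : ℝ≥0} {t : ℝ≥0}

lemma isCompact_levelSet (h : IsConformalExtension X φ V ψ K) (hc : IsCompact X) (n : ℕ) :
    IsCompact (levelSet X φ n) := by
  refine isCompact_iUnion fun ω => hc.image_of_continuousOn ?_
  refine ContinuousOn.congr (fun x hx => ?_) (h.eqOn_word le_rfl ω).symm
  exact (h.conformalAt_word le_rfl ω (h.subset hx)).differentiableAt.continuousAt.continuousWithinAt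

lemma isCompact_limitSet (h : IsConformalExtension X φ V ψ K) (hc : IsCompact X) :
    IsCompact (limitSet X φ) := by
  rw [limitSet_eq_iInter_levelSet h.mapsTo_base]
  exact (h.isCompact_levelSet hc 0).of_isClosed_subset
    (isClosed_iInter fun n => (h.isCompact_levelSet hc n).isClosed) (iInter_subset _ 0)

lemma eventually_levelSet_subset (h : IsConformalExtension X φ V ψ K) (hc : IsCompact X)
    {U : Set E} (hU : IsOpen U) (hJ : limitSet X φ ⊆ U) :
    ∀ᶠ n in atTop, levelSet X φ n ⊆ U := by
  rw [limitSet_eq_iInter_levelSet h.mapsTo_base] at hJ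
  have hanti := antitone_levelSet h.mapsTo_base
  obtain ⟨N, hN⟩ := exists_subset_nhds_of_isCompact' hanti.directed_ge (h.isCompact_levelSet hc)
    (fun n => (h.isCompact_levelSet hc n).isClosed) fun y hy => hU.mem_nhds (hJ hy)
  exact (eventually_ge_atTop N).mono fun n hn => (hanti hn).trans hN

variable [Nontrivial E] [Nonempty I]

lemma exists_ball_mass_le [FiniteDimensional ℝ E] (h : IsConformalExtension X φ V ψ K)
    (hd : ∀ j, 1 ≤ j → ∀ a b, a ≠ b → Disjoint (φ j a '' interior X) (φ j b '' interior X))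
    (hb : Bornology.IsBounded X) (hcone : HasFatCones X) (hP : 0 < (wordNorm X φ).pressure t) :
    ∃ C : ℝ≥0, ∀ (x : E) (r : ℝ≥0), 0 < r → r < 1 → ∀ n,
      (∀ ω : Fin n → I, wordNorm X φ n 1 ω ≤ r) →
        ∑' ω : {ω : Fin n → I | (wordMap φ n 1 ω '' X ∩ Metric.ball x r).Nonempty},
          wordNorm X φ n 1 ω ^ (t : ℝ) ≤
            C * (r : ℝ≥0∞) ^ (t : ℝ) * (wordNorm X φ).levelSum n 1 t := by
  have hw := h.isQuasiMultiplicative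
  obtain ⟨C, hC⟩ := h.exists_encard_le hd hb hcone
  have htop : (C : ℝ≥0∞) * ENat.card I * (K : ℝ≥0∞) ^ (t : ℝ) *
      ∑' k, ((wordNorm X φ).levelSum k 1 t)⁻¹ ≠ ∞ :=
    ENNReal.mul_ne_top (ENNReal.mul_ne_top (ENNReal.mul_ne_top ENNReal.coe_ne_top
        (ENat.toENNReal_ne_top.2 (ENat.card_lt_top.2 inferInstance).ne))
      (ENNReal.rpow_ne_top_of_nonneg t.coe_nonneg ENNReal.coe_ne_top))
      (tsum_inv_ne_top_of_expGrowthInf_pos (fun n => hw.levelSum_ne_zero le_rfl t) hP)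
  refine ⟨_, fun x r hr hr1 n hn => (ENNReal.coe_toNNReal htop).symm ▸
    hw.tsum_le_of_encard_le (S := fun k =>
      {ω : Fin k → I | (wordMap φ k 1 ω '' X ∩ Metric.ball x r).Nonempty})
    (by exact_mod_cast hr1) (fun k ω hω => hω.mono ?_) (fun k => ?_) hn t⟩
  · exact inter_subset_inter_left _ (image_wordMap_succ_subset h.mapsTo_base ω)
  · simpa only [mem_ofPred_eq, and_comm, ENNReal.ofReal_coe_nnreal] using
      hC k 1 le_rfl x r (by exact_mod_cast hr)

lemma one_le_mul_sum_of_ball_cover (h : IsConformalExtension X φ V ψ K) {C : ℝ≥0} {n : ℕ}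
    {s : Finset ℕ} {x : ℕ → E} {r : ℕ → ℝ≥0}
    (hcov : levelSet X φ n ⊆ ⋃ j ∈ s, Metric.ball (x j) (r j))
    (hmass : ∀ j ∈ s,
      ∑' ω : {ω : Fin n → I | (wordMap φ n 1 ω '' X ∩ Metric.ball (x j) (r j)).Nonempty},
        wordNorm X φ n 1 ω ^ (t : ℝ) ≤
          C * (r j : ℝ≥0∞) ^ (t : ℝ) * (wordNorm X φ).levelSum n 1 t) :
    1 ≤ C * ∑ j ∈ s, (r j : ℝ≥0∞) ^ (t : ℝ) := by
  have hw := h.isQuasiMultiplicative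
  set S : s → Set (Fin n → I) := fun j =>
    {ω | (wordMap φ n 1 ω '' X ∩ Metric.ball (x j) (r j)).Nonempty}
  have hmeet : ⋃ j, S j = univ := by
    refine eq_univ_of_forall fun ω => ?_
    obtain ⟨y, hy⟩ := h.nonempty
    obtain ⟨j, hj, hyj⟩ := mem_iUnion₂.1 (hcov (mem_iUnion.2 ⟨ω, y, hy, rfl⟩))
    exact mem_iUnion.2 ⟨⟨j, hj⟩, _, ⟨y, hy, rfl⟩, hyj⟩
  rw [← ENNReal.mul_le_mul_iff_left (hw.levelSum_ne_zero (n := n) le_rfl t)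
    (hw.levelSum_ne_top le_rfl t)]
  calc 1 * (wordNorm X φ).levelSum n 1 t
      = ∑' ω : ⋃ j, S j, wordNorm X φ n 1 ω ^ (t : ℝ) := by
        rw [hmeet, one_mul, tsum_univ fun ω => wordNorm X φ n 1 ω ^ (t : ℝ)]
        rfl
    _ ≤ ∑ j, ∑' ω : S j, wordNorm X φ n 1 ω ^ (t : ℝ) :=
        ENNReal.tsum_iUnion_le (fun ω => wordNorm X φ n 1 ω ^ (t : ℝ)) S
    _ ≤ ∑ j : s, C * (r j : ℝ≥0∞) ^ (t : ℝ) * (wordNorm X φ).levelSum n 1 t :=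
        Finset.sum_le_sum fun j _ => hmass j j.2
    _ = _ := by
        rw [Finset.sum_coe_sort s fun j =>
          C * (r j : ℝ≥0∞) ^ (t : ℝ) * (wordNorm X φ).levelSum n 1 t, Finset.mul_sum,
          Finset.sum_mul]

end IsConformalExtension

namespace IsConformalExtension

variable {E I : Type*} [NormedAddCommGroup E] [InnerProductSpace ℝ E] [FiniteDimensional ℝ E]
  [Nontrivial E] {X V : Set E} {φ ψ : ℕ → I → E → E} {K t : ℝ≥0} {η : ℝ} {M : ℕ}

lemma le_dimH_limitSet_of_finite [Finite I] (h : IsConformalExtension X φ V ψ K)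
    (hd : ∀ j, 1 ≤ j → ∀ a b, a ≠ b → Disjoint (φ j a '' interior X) (φ j b '' interior X))
    (hX : IsCompact X) (hcone : HasFatCones X) (hη : (wordNorm X φ).IsContracting η M)
    (hP : 0 < (wordNorm X φ).pressure t) : t ≤ dimH (limitSet X φ) := by
  rcases eq_zero_or_pos t with rfl | ht
  · simp
  rcases isEmpty_or_nonempty I with hI | hI
  · simp [WordWeight.pressure_of_isEmpty] at hP
  obtain ⟨C, hC⟩ := h.exists_ball_mass_le hd hX.isBounded hcone hP
  refine le_dimH_of_forall_finite_ball_cover (h.isCompact_limitSet hX) ht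
    (C := C) fun s x r hr hr1 hcov => ?_
  have hsmall : ∀ᶠ n in atTop, ∀ j ∈ s, ∀ ω : Fin n → I, wordNorm X φ n 1 ω ≤ r j := by
    rw [eventually_all_finset]
    exact fun j _ => (hη.eventually_le (ENNReal.coe_pos.2 (hr j))).mono fun n hn => hn 1 le_rfl
  obtain ⟨n, hcovn, hn⟩ := ((h.eventually_levelSet_subset hX
    (isOpen_biUnion fun _ _ => Metric.isOpen_ball) hcov).and hsmall).exists
  exact h.one_le_mul_sum_of_ball_cover hcovn fun j hj => hC _ _ (hr j) (hr1 j) n (hn j hj)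

lemma le_dimH_limitSet (h : IsConformalExtension X φ V ψ K)
    (hd : ∀ j, 1 ≤ j → ∀ a b, a ≠ b → Disjoint (φ j a '' interior X) (φ j b '' interior X))
    (hX : IsCompact X) (hcone : HasFatCones X) (hη : (wordNorm X φ).IsContracting η M)
    {a : I → ℝ≥0∞} {D : ℝ≥0∞} (ha : (wordNorm X φ).HasComparableLetters a D)
    (hP : 0 < (wordNorm X φ).pressure t) : t ≤ dimH (limitSet X φ) := by
  rcases isEmpty_or_nonempty I with hI | hI
  · simp [WordWeight.pressure_of_isEmpty] at hP
  obtain ⟨F, hF⟩ := ha.exists_finset_pressure_pos h.isQuasiMultiplicative hP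
  have hηF := hη.comap ((↑) : F → I)
  rw [← wordNorm_comp_letters] at hF hηF
  exact ((h.comp_letters ((↑) : F → I)).le_dimH_limitSet_of_finite
    (fun j hj a b hab => hd j hj a b (Subtype.coe_injective.ne hab)) hX hcone hηF hF).trans
    (dimH_mono (limitSet_comp_letters_subset X φ _))

end IsConformalExtension

section RandomSystems

lemma erealExpectation_of_ae_eq_const {Λ : Type*} [MeasurableSpace Λ] {m : Measure Λ}
    [IsProbabilityMeasure m] {f : Λ → EReal} {c : EReal} (h : ∀ᵐ lam ∂m, f lam = c) :
    erealExpectation m f = c := by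
  have hlintegral : ∀ F : EReal → ℝ≥0∞, ∫⁻ lam, F (f lam) ∂m = F c := fun F => by
    rw [lintegral_congr_ae (g := fun _ => F c) (h.mono fun lam hlam => congrArg F hlam)]
    simp
  rw [erealExpectation, hlintegral EReal.toENNReal, hlintegral fun y => (-y).toENNReal]
  rcases le_total 0 c with hc | hc
  · rw [EReal.toENNReal_of_nonpos (x := -c) (by simpa using hc), EReal.coe_toENNReal hc]
    simp
  · rw [EReal.toENNReal_of_nonpos hc, EReal.coe_toENNReal (x := -c) (by simpa using hc)]
    simp

lemma measurable_fderiv_apply {Λ E F : Type*} [MeasurableSpace Λ] [NormedAddCommGroup E]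
    [NormedSpace ℝ E] [NormedAddCommGroup F] [NormedSpace ℝ F] [MeasurableSpace F] [BorelSpace F]
    [SecondCountableTopology F] {f : Λ → E → F} {x : E} {U : Set E} (hU : U ∈ 𝓝 x)
    (hf : ∀ y ∈ U, Measurable fun lam => f lam y) (hd : ∀ lam, DifferentiableAt ℝ (f lam) x)
    (v : E) : Measurable fun lam => fderiv ℝ (f lam) x v := by
  have hlim : Tendsto (fun c : ℝ => x + c⁻¹ • v) atTop (𝓝 (x + (0 : ℝ) • v)) :=
    tendsto_const_nhds.add (tendsto_inv_atTop_zero.smul_const v)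
  rw [zero_smul, add_zero] at hlim
  obtain ⟨N, hN⟩ := eventually_atTop.1 (hlim.eventually hU)
  have hseq : Tendsto (fun k : ℕ => (k : ℝ) + N) atTop atTop :=
    tendsto_atTop_add_const_right _ _ tendsto_natCast_atTop_atTop
  refine measurable_of_tendsto_metrizable
    (f := fun (k : ℕ) lam => ((k : ℝ) + N) • (f lam (x + ((k : ℝ) + N)⁻¹ • v) - f lam x))
    (fun k => ?_) (tendsto_pi_nhds.2 fun lam => ((hd lam).hasFDerivAt.lim_real v).comp hseq)
  exact ((hf _ (hN _ (by simp))).sub (hf x (mem_of_mem_nhds hU))).const_smul ((k : ℝ) + N)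

lemma IsConformalExtension.pressure_eq_expGrowthInf {E I : Type*} [NormedAddCommGroup E]
    [InnerProductSpace ℝ E] {X V : Set E} {φ ψ : ℕ → I → E → E} {K : ℝ≥0}
    (h : IsConformalExtension X φ V ψ K) {x : E} (hx : x ∈ X) (t : ℝ≥0) :
    (wordNorm X φ).pressure t = ExpGrowth.expGrowthInf fun n =>
      ∑' ω : Fin n → I, ‖fderivWithin ℝ (wordMap φ n 1 ω) X x‖ₑ ^ (t : ℝ) := by
  refine le_antisymm ?_ ?_
  · refine ExpGrowth.expGrowthInf_le_of_eventually_le (b := (K : ℝ≥0∞) ^ (t : ℝ))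
      (ENNReal.rpow_ne_top_of_nonneg t.coe_nonneg ENNReal.coe_ne_top)
      (Eventually.of_forall fun n => ?_)
    rw [WordWeight.levelSum, ← ENNReal.tsum_mul_left]
    refine ENNReal.tsum_le_tsum fun ω => ?_
    rw [← ENNReal.mul_rpow_of_nonneg _ _ t.coe_nonneg, h.fderivWithin_word le_rfl ω hx]
    exact ENNReal.rpow_le_rpow (h.wordNorm_le le_rfl ω (h.subset hx)) t.coe_nonneg
  · refine ExpGrowth.expGrowthInf_monotone fun n => ENNReal.tsum_le_tsum fun ω => ?_
    rw [h.fderivWithin_word le_rfl ω hx]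
    exact ENNReal.rpow_le_rpow (h.enorm_fderiv_le le_rfl ω hx) t.coe_nonneg

variable {Λ I : Type*}

lemma fiberSystem_symm_one {E : Type*} [MeasurableSpace Λ] (T : Λ ≃ᵐ Λ) (φ : Λ → I → E → E)
    (lam : Λ) : fiberSystem T φ (T.symm lam) 1 = φ lam := by
  funext i
  simp [fiberSystem]

lemma wordNorm_fiberSystem_apply {E : Type*} [NormedAddCommGroup E] [NormedSpace ℝ E] (X : Set E)
    (T : Λ → Λ) (φ : Λ → I → E → E) (lam : Λ) :
    wordNorm X (fiberSystem T φ (T lam)) = (wordNorm X (fiberSystem T φ lam)).shift :=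
  wordNorm_shift X (fiberSystem T φ lam)

namespace IsRandomCIFS

variable {d : ℕ} [MeasurableSpace Λ] {m : Measure Λ} {T : Λ ≃ᵐ Λ}
  {X : Set (EuclideanSpace ℝ (Fin d))}
  {φ : Λ → I → EuclideanSpace ℝ (Fin d) → EuclideanSpace ℝ (Fin d)}

lemma mapsTo (hφ : IsRandomCIFS X m T φ) (lam : Λ) (i : I) : MapsTo (φ lam i) X X :=
  fiberSystem_symm_one T φ lam ▸ (hφ.isNCIFS (T.symm lam)).mapsTo 1 le_rfl i

lemma continuousOn (hφ : IsRandomCIFS X m T φ) (hX : IsPhaseSpace X) (lam : Λ) (i : I) :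
    ContinuousOn (φ lam i) X := by
  obtain ⟨V, ψ, K, h⟩ := (hφ.isNCIFS (T.symm lam)).exists_extension hX
  rw [← fiberSystem_symm_one T φ lam]
  exact ((h.contDiffOn 1 le_rfl i).continuousOn.mono h.subset).congr (h.eqOn 1 le_rfl i).symm

lemma derivNorm_ne_top (hφ : IsRandomCIFS X m T φ) (hX : IsPhaseSpace X) (lam : Λ) (i : I) :
    derivNorm X (φ lam i) ≠ ∞ := by
  obtain ⟨V, ψ, K, h⟩ := (hφ.isNCIFS (T.symm lam)).exists_extension hX
  rw [← fiberSystem_symm_one T φ lam]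
  exact h.wordNorm_ne_top le_rfl fun _ : Fin 1 => i

lemma measurable_wordMap (hφ : IsRandomCIFS X m T φ) (hX : IsPhaseSpace X) {n k : ℕ}
    (ω : Fin n → I) {x : EuclideanSpace ℝ (Fin d)} (hx : x ∈ X) :
    Measurable fun lam => wordMap (fiberSystem T φ lam) n k ω x := by
  induction n generalizing k with
  | zero => exact measurable_const
  | succ n ih =>
    have hjoint : Measurable (Function.uncurry fun (y : X) (lam : Λ) => φ lam (ω 0) y) :=
      measurable_uncurry_of_continuous_of_measurable
        (fun lam => (hφ.continuousOn hX lam (ω 0)).domRestrict)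
        (fun y => hφ.measurable (ω 0) y y.2)
    have hmem : ∀ lam, wordMap (fiberSystem T φ lam) n (k + 1) (Fin.tail ω) x ∈ X := fun lam =>
      mapsTo_wordMap (fun j _ i => hφ.mapsTo (T^[j] lam) i) (by omega) _ hx
    exact hjoint.comp ((ih (Fin.tail ω)).subtype_mk (h := hmem) |>.prodMk (T.measurable.iterate k))

lemma conformalAt_wordMap (hφ : IsRandomCIFS X m T φ) (hX : IsPhaseSpace X) (lam : Λ) {n : ℕ}
    (ω : Fin n → I) {x : EuclideanSpace ℝ (Fin d)} (hx : x ∈ interior X) :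
    ConformalAt (wordMap (fiberSystem T φ lam) n 1 ω) x := by
  obtain ⟨V, ψ, K, h⟩ := (hφ.isNCIFS lam).exists_extension hX
  exact (h.conformalAt_word le_rfl ω (h.subset (interior_subset hx))).congr hx isOpen_interior
    fun y hy => (h.eqOn_word le_rfl ω (interior_subset hy)).symm

lemma dimH_limitSet_le [Countable I] (hφ : IsRandomCIFS X m T φ) (hX : IsPhaseSpace X) (lam : Λ)
    {t : ℝ≥0} (hP : lowerPressure X (fiberSystem T φ lam) t ≤ 0) :
    dimH (limitSet X (fiberSystem T φ lam)) ≤ t := by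
  obtain ⟨V, ψ, K, h⟩ := (hφ.isNCIFS lam).exists_extension hX
  obtain ⟨η, M, hη⟩ := (hφ.isNCIFS lam).exists_isContracting
  exact h.dimH_limitSet_le hX.isCompact hη (lowerPressure_eq_pressure X _ t ▸ hP)

variable [Nontrivial (EuclideanSpace ℝ (Fin d))]

lemma derivNorm_ne_zero (hφ : IsRandomCIFS X m T φ) (hX : IsPhaseSpace X) (lam : Λ) (i : I) :
    derivNorm X (φ lam i) ≠ 0 := by
  obtain ⟨V, ψ, K, h⟩ := (hφ.isNCIFS (T.symm lam)).exists_extension hX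
  rw [← fiberSystem_symm_one T φ lam]
  exact h.wordNorm_ne_zero le_rfl fun _ : Fin 1 => i

lemma measurable_enorm_fderivWithin (hφ : IsRandomCIFS X m T φ) (hX : IsPhaseSpace X) {n : ℕ}
    (ω : Fin n → I) {x : EuclideanSpace ℝ (Fin d)} (hx : x ∈ interior X) :
    Measurable fun lam => ‖fderivWithin ℝ (wordMap (fiberSystem T φ lam) n 1 ω) X x‖ₑ := by
  obtain ⟨v, hv⟩ := exists_norm_eq (EuclideanSpace ℝ (Fin d)) zero_le_one
  have hXx : X ∈ 𝓝 x := mem_interior_iff_mem_nhds.1 hx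
  have hconf := fun lam => hφ.conformalAt_wordMap hX lam ω hx
  have heq : ∀ lam, ‖fderivWithin ℝ (wordMap (fiberSystem T φ lam) n 1 ω) X x‖ₑ =
      ‖fderiv ℝ (wordMap (fiberSystem T φ lam) n 1 ω) x v‖ₑ := fun lam => by
    rw [fderivWithin_of_mem_nhds hXx, ← ofReal_norm, ← ofReal_norm,
      norm_apply_of_isConformalMap (isConformalMap_fderiv_of_conformalAt (hconf lam)), hv, mul_one]
  simp only [heq]
  exact (measurable_fderiv_apply hXx (fun y hy => hφ.measurable_wordMap hX ω hy)
    (fun lam => (hconf lam).differentiableAt) v).enorm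

variable [Countable I]

lemma measurable_lowerPressure (hφ : IsRandomCIFS X m T φ) (hX : IsPhaseSpace X) (t : ℝ≥0) :
    Measurable fun lam => lowerPressure X (fiberSystem T φ lam) t := by
  obtain ⟨x, hx⟩ : (interior X).Nonempty :=
    closure_nonempty_iff.1 (hX.closure_interior.symm ▸ hX.nonempty)
  have heq : ∀ lam, lowerPressure X (fiberSystem T φ lam) t = ExpGrowth.expGrowthInf fun n =>
      ∑' ω : Fin n → I,
        ‖fderivWithin ℝ (wordMap (fiberSystem T φ lam) n 1 ω) X x‖ₑ ^ (t : ℝ) := fun lam => by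
    obtain ⟨V, ψ, K, h⟩ := (hφ.isNCIFS lam).exists_extension hX
    rw [lowerPressure_eq_pressure, h.pressure_eq_expGrowthInf (interior_subset hx)]
  simp only [heq]
  exact Measurable.liminf fun n =>
    (EReal.monotone_div_right_of_nonneg (by positivity)).measurable.comp
      (ENNReal.measurable_log.comp (Measurable.tsum fun ω =>
        (hφ.measurable_enorm_fderivWithin hX ω hx).pow_const _))

variable [IsProbabilityMeasure m]

lemma exists_ae_hasComparableLetters (hφ : IsRandomCIFS X m T φ) (hX : IsPhaseSpace X)
    (hI : (⨆ i, essSup (fun lam => derivNorm X (φ lam i)) m /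
      essInf (fun lam => derivNorm X (φ lam i)) m) < ∞) :
    ∃ (a : I → ℝ≥0∞) (D : ℝ≥0∞),
      ∀ᵐ lam ∂m, (wordNorm X (fiberSystem T φ lam)).HasComparableLetters a D := by
  set a : I → ℝ≥0∞ := fun i => essInf (fun lam => derivNorm X (φ lam i)) m
  set b : I → ℝ≥0∞ := fun i => essSup (fun lam => derivNorm X (φ lam i)) m
  have hlow : ∀ i, ∀ᵐ lam ∂m, a i ≤ derivNorm X (φ lam i) := fun i => ae_essInf_le
  have hup : ∀ i, ∀ᵐ lam ∂m, derivNorm X (φ lam i) ≤ b i := fun i => ENNReal.ae_le_essSup _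
  have hatop : ∀ i, a i ≠ ∞ := fun i => by
    obtain ⟨lam, hlam⟩ := (hlow i).exists
    exact ne_top_of_le_ne_top (hφ.derivNorm_ne_top hX lam i) hlam
  have hb0 : ∀ i, b i ≠ 0 := fun i => by
    obtain ⟨lam, hlam⟩ := (hup i).exists
    exact ((pos_iff_ne_zero.2 (hφ.derivNorm_ne_zero hX lam i)).trans_le hlam).ne'
  have hratio : ∀ i, b i / a i ≤ ⨆ i, b i / a i := le_iSup fun i => b i / a i
  have ha0 : ∀ i, a i ≠ 0 := fun i h0 => by
    have hlt := (hratio i).trans_lt hI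
    simp [h0, ENNReal.div_zero (hb0 i)] at hlt
  have hlevels : ∀ᵐ lam ∂m, ∀ j i,
      a i ≤ derivNorm X (φ (T^[j] lam) i) ∧ derivNorm X (φ (T^[j] lam) i) ≤ b i :=
    ae_all_iff.2 fun j => ae_all_iff.2 fun i =>
      (hφ.ergodic.toMeasurePreserving.iterate j).quasiMeasurePreserving.ae ((hlow i).and (hup i))
  refine ⟨a, ⨆ i, b i / a i, hlevels.mono fun lam hlam =>
    ⟨hI.ne, ha0, hatop, fun k _ i => (hlam k i).1, fun k _ i => (hlam k i).2.trans ?_⟩⟩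
  exact (ENNReal.div_le_iff (ha0 i) (hatop i)).1 (hratio i)

lemma ae_pressure_shift (hφ : IsRandomCIFS X m T φ) (hX : IsPhaseSpace X)
    (hI : Infinite I → (⨆ i, essSup (fun lam => derivNorm X (φ lam i)) m /
      essInf (fun lam => derivNorm X (φ lam i)) m) < ∞) (t : ℝ≥0) :
    ∀ᵐ lam ∂m, (wordNorm X (fiberSystem T φ lam)).shift.pressure t =
      (wordNorm X (fiberSystem T φ lam)).pressure t := by
  rcases isEmpty_or_nonempty I with hempty | hnonempty
  · exact .of_forall fun lam => by simp only [WordWeight.pressure_of_isEmpty]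
  rcases finite_or_infinite I with hfin | hinf
  · refine .of_forall fun lam => ?_
    obtain ⟨V, ψ, K, h⟩ := (hφ.isNCIFS lam).exists_extension hX
    have hw := h.isQuasiMultiplicative
    exact hw.pressure_shift (hw.levelSum_ne_zero le_rfl t) (hw.levelSum_ne_top le_rfl t)
  · obtain ⟨a, D, hcomp⟩ := hφ.exists_ae_hasComparableLetters hX (hI hinf)
    filter_upwards [hcomp] with lam ha
    obtain ⟨V, ψ, K, h⟩ := (hφ.isNCIFS lam).exists_extension hX
    exact ha.pressure_shift h.isQuasiMultiplicative t

lemma ae_lowerPressure_eq (hφ : IsRandomCIFS X m T φ) (hX : IsPhaseSpace X)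
    (hI : Infinite I → (⨆ i, essSup (fun lam => derivNorm X (φ lam i)) m /
      essInf (fun lam => derivNorm X (φ lam i)) m) < ∞) (t : ℝ≥0) :
    ∀ᵐ lam ∂m, lowerPressure X (fiberSystem T φ lam) t = expectedPressure X m T φ t := by
  have hinv : ∀ᵐ lam ∂m, lowerPressure X (fiberSystem T φ (T lam)) t =
      lowerPressure X (fiberSystem T φ lam) t := by
    simpa only [lowerPressure_eq_pressure, wordNorm_fiberSystem_apply] using
      hφ.ae_pressure_shift hX hI t
  obtain ⟨c, hc⟩ := hφ.ergodic.ae_eq_const_of_ae_eq_comp₀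
    (hφ.measurable_lowerPressure hX t).nullMeasurable hinv
  have hexp : expectedPressure X m T φ t = c := erealExpectation_of_ae_eq_const hc
  rwa [hexp]

lemma antitone_expectedPressure (hφ : IsRandomCIFS X m T φ) (hX : IsPhaseSpace X)
    (hI : Infinite I → (⨆ i, essSup (fun lam => derivNorm X (φ lam i)) m /
      essInf (fun lam => derivNorm X (φ lam i)) m) < ∞) :
    Antitone (expectedPressure X m T φ) := by
  intro s t hst
  obtain ⟨lam, hs, ht⟩ :=
    ((hφ.ae_lowerPressure_eq hX hI s).and (hφ.ae_lowerPressure_eq hX hI t)).exists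
  obtain ⟨η, M, hη⟩ := (hφ.isNCIFS lam).exists_isContracting
  rw [← hs, ← ht, lowerPressure_eq_pressure, lowerPressure_eq_pressure]
  exact hη.antitone_pressure hst

lemma ae_le_dimH_limitSet (hφ : IsRandomCIFS X m T φ) (hX : IsPhaseSpace X)
    (hI : Infinite I → (⨆ i, essSup (fun lam => derivNorm X (φ lam i)) m /
      essInf (fun lam => derivNorm X (φ lam i)) m) < ∞) :
    ∀ᵐ lam ∂m, ∀ t : ℝ≥0, 0 < lowerPressure X (fiberSystem T φ lam) t →
      t ≤ dimH (limitSet X (fiberSystem T φ lam)) := by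
  simp only [lowerPressure_eq_pressure]
  rcases finite_or_infinite I with hfin | hinf
  · refine .of_forall fun lam t hP => ?_
    obtain ⟨V, ψ, K, h⟩ := (hφ.isNCIFS lam).exists_extension hX
    obtain ⟨η, M, hη⟩ := (hφ.isNCIFS lam).exists_isContracting
    exact h.le_dimH_limitSet_of_finite (hφ.isNCIFS lam).disjoint_images hX.isCompact
      hX.hasFatCones hη hP
  · obtain ⟨a, D, hcomp⟩ := hφ.exists_ae_hasComparableLetters hX (hI hinf)
    filter_upwards [hcomp] with lam ha t hP
    obtain ⟨V, ψ, K, h⟩ := (hφ.isNCIFS lam).exists_extension hX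
    obtain ⟨η, M, hη⟩ := (hφ.isNCIFS lam).exists_isContracting
    exact h.le_dimH_limitSet (hφ.isNCIFS lam).disjoint_images hX.isCompact hX.hasFatCones hη ha hP

end IsRandomCIFS

end RandomSystems

lemma eq_iInf_of_forall_rat {α : Type*} [LinearOrder α] {P : ℝ≥0 → α} (hP : Antitone P) {c : α}
    {D : ℝ≥0∞} (hle : ∀ q : ℚ, P (Real.toNNReal q) ≤ c → D ≤ Real.toNNReal q)
    (hge : ∀ q : ℚ, c < P (Real.toNNReal q) → Real.toNNReal q ≤ D) :
    D = ⨅ (t : ℝ≥0) (_ : P t ≤ c), (t : ℝ≥0∞) := by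
  refine le_antisymm (le_iInf₂ fun t ht => le_of_forall_gt_imp_ge_of_dense fun b hb => ?_)
    (le_of_forall_lt_imp_le_of_dense fun b hb => ?_)
  · obtain ⟨q, -, htq, hqb⟩ := ENNReal.lt_iff_exists_rat_btwn.1 hb
    exact (hle q ((hP (by exact_mod_cast htq.le)).trans ht)).trans hqb.le
  · obtain ⟨q, -, hbq, hq⟩ := ENNReal.lt_iff_exists_rat_btwn.1 hb
    refine hbq.le.trans (hge q (lt_of_not_ge fun hqc => hq.not_ge ?_))
    exact iInf₂_le (f := fun (t : ℝ≥0) (_ : P t ≤ c) => (t : ℝ≥0∞)) _ hqc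

theorem mainTheorem10 {d : ℕ} (hd : 1 ≤ d) {Λ I : Type*} [MeasurableSpace Λ] [Countable I]
    (m : Measure Λ) [IsProbabilityMeasure m] (T : Λ ≃ᵐ Λ)
    (X : Set (EuclideanSpace ℝ (Fin d))) (hX : IsPhaseSpace X)
    (φ : Λ → I → EuclideanSpace ℝ (Fin d) → EuclideanSpace ℝ (Fin d))
    (hφ : IsRandomCIFS X m T φ)
    (hI : Infinite I →
      (⨆ i, essSup (fun lam => derivNorm X (φ lam i)) m /
        essInf (fun lam => derivNorm X (φ lam i)) m) < ∞) :
    (∀ t : ℝ≥0, ∀ᵐ lam ∂m,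
      lowerPressure X (fiberSystem T φ lam) t = expectedPressure X m T φ t) ∧
    ∀ᵐ lam ∂m, dimH (limitSet X (fiberSystem T φ lam)) =
      ⨅ (t : ℝ≥0) (_ : expectedPressure X m T φ t ≤ 0), (t : ℝ≥0∞) := by
  have : Nontrivial (EuclideanSpace ℝ (Fin d)) :=
    Module.nontrivial_of_finrank_pos (R := ℝ) (by simpa using Nat.lt_of_succ_le hd)
  have hae := hφ.ae_lowerPressure_eq hX hI
  refine ⟨hae, ?_⟩
  have hrat : ∀ᵐ lam ∂m, ∀ q : ℚ, lowerPressure X (fiberSystem T φ lam) (Real.toNNReal q) =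
      expectedPressure X m T φ (Real.toNNReal q) := ae_all_iff.2 fun q => hae _
  filter_upwards [hrat, hφ.ae_le_dimH_limitSet hX hI] with lam hlam hlower
  refine eq_iInf_of_forall_rat (hφ.antitone_expectedPressure hX hI) (fun q hq => ?_) fun q hq => ?_
  · exact hφ.dimH_limitSet_le hX lam ((hlam q).trans_le hq)
  · exact hlower _ (hq.trans_eq (hlam q).symm)
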